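/- For $g\in L^2(\mathbb R)$ let $G(g)=\{e^{2\pi i m x}g(x-n)\}_{(m,n)\in\mathbb Z^2}$ and let $\widehat g$ be its Fourier transform, the unitary extension to $L^2(\mathbb R)$ of $\widehat g(\xi)=\int_{\mathbb R} g(x)e^{-2\pi i x\xi}\,dx$. A system $\{f_n\}$ in a Hilbert space $H$ is called exact if it is complete (its closed linear span is $H$) and minimal (each $f_n$ lies outside the closed linear span of the remaining elements). For $2\le q<\infty$ it is called a $(C_q)$-system if there is a constant $C>0$ such that every $f\in H$ can be approximated arbitrarily well by finite linear combinations $\sum a_nf_n$ with $\left(\sum|a_n|^q\right)^{1/q}\le C\|f\|_H$. An exact $(C_q)$-system is a $(C_q)$-system that is exact. Theorem. Let $2<q<\infty$, let $q'=q/(q-1)$, and let $t\ge r>\frac{4(q-1)}{q+2}$ be real numbers such that $$\frac1r+\frac1t\le\frac{q'}{2}.$$ Let $g\in L^2(\mathbb R)$. If $G(g)$ is an exact $(C_q)$-system for $L^2(\mathbb R)$, then $$\int_{\mathbb R}|x|^r|g(x)|^2\,dx=\infty\quad\text{or}\quad\int_{\mathbb R}|\xi|^t|\widehat g(\xi)|^2\,d\xi=\infty,$$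 and likewise, with $r$ and $t$ interchanged, $$\int_{\mathbb R}|x|^t|g(x)|^2\,dx=\infty\quad\text{or}\quad\int_{\mathbb R}|\xi|^r|\widehat g(\xi)|^2\,d\xi=\infty.$$ -/

import Mathlib

open MeasureTheory
open scoped FourierTransform ENNReal

noncomputable section

section Systems

variable {ι H : Type*} [NormedAddCommGroup H] [InnerProductSpace ℂ H]

/-- A system is complete if its closed linear span is the whole space. -/
def IsCompleteSystem (f : ι → H) : Prop :=
  (Submodule.span ℂ (Set.range f)).topologicalClosure = ⊤

/-- A system is minimal if each of its elements lies outside the closed linear span of the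
remaining elements. -/
def IsMinimalSystem (f : ι → H) : Prop :=
  ∀ i, f i ∉ (Submodule.span ℂ (f '' {j | j ≠ i})).topologicalClosure

/-- A system is exact if it is both complete and minimal. -/
def IsExactSystem (f : ι → H) : Prop :=
  IsCompleteSystem f ∧ IsMinimalSystem f

/-- The `ℓ^q` norm of a finite family of coefficients (for a finite exponent `q`). -/
def finiteLqNorm (q : ℝ) (a : ι →₀ ℂ) : ℝ :=
  (∑ i ∈ a.support, ‖a i‖ ^ q) ^ (1 / q)

/-- A system is a `(C_q)`-system if there is a constant `C > 0` such that every `h` can be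
approximated arbitrarily well by finite linear combinations `∑ a i • f i` whose coefficients
satisfy `‖a‖_{ℓ^q} ≤ C ‖h‖`. -/
def IsCqSystem (q : ℝ) (f : ι → H) : Prop :=
  ∃ C : ℝ, 0 < C ∧ ∀ h : H, ∀ ε : ℝ, 0 < ε →
    ∃ a : ι →₀ ℂ, ‖h - ∑ i ∈ a.support, a i • f i‖ < ε ∧ finiteLqNorm q a ≤ C * ‖h‖

/-- An exact `(C_q)`-system. -/
def IsExactCqSystem (q : ℝ) (f : ι → H) : Prop :=
  IsExactSystem f ∧ IsCqSystem q f

end Systems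

/-- The time-frequency shift `x ↦ e^{2πimx} g(x - n)` as a function on `ℝ`. -/
def gaborFun (g : Lp ℂ 2 (volume : Measure ℝ)) (m n : ℤ) (x : ℝ) : ℂ :=
  Complex.exp (2 * Real.pi * Complex.I * m * x) * g (x - n)

theorem memLp_gaborFun (g : Lp ℂ 2 (volume : Measure ℝ)) (m n : ℤ) :
    MemLp (gaborFun g m n) 2 volume := by
  have h1 : MemLp (fun x : ℝ => g (x - n)) 2 volume :=
    (Lp.memLp g).comp_measurePreserving (measurePreserving_sub_right volume (n : ℝ))
  refine h1.of_le ?_ ?_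
  · exact AEStronglyMeasurable.mul (by fun_prop) h1.1
  · refine Filter.Eventually.of_forall fun x => ?_
    have h2 : ‖Complex.exp (2 * Real.pi * Complex.I * m * x)‖ = 1 := by
      have h3 : (2 * Real.pi * Complex.I * m * x : ℂ)
          = ((2 * Real.pi * m * x : ℝ) : ℂ) * Complex.I := by
        push_cast; ring
      rw [h3, Complex.norm_exp_ofReal_mul_I]
    simp only [gaborFun, norm_mul, h2, one_mul, le_refl]

/-- The Gabor system `G(g) = {e^{2πimx} g(x - n)}`, indexed by `(m, n) ∈ ℤ²`, in `L²(ℝ)`. -/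
def gaborSystem (g : Lp ℂ 2 (volume : Measure ℝ)) : ℤ × ℤ → Lp ℂ 2 (volume : Measure ℝ) :=
  fun p => (memLp_gaborFun g p.1 p.2).toLp (gaborFun g p.1 p.2)

/-- The moment `∫ |x|^s |f(x)|² dx`, as a value in `[0, ∞]`. -/
def momentL2 (s : ℝ) (f : Lp ℂ 2 (volume : Measure ℝ)) : ℝ≥0∞ :=
  ∫⁻ x : ℝ, ENNReal.ofReal (|x| ^ s * ‖f x‖ ^ 2)

end

/-!
The Zak transform `Z(x, y) = ∑ₙ g(x + n) e^{2πiny}` is quasiperiodic, so it has a zero `(x₀, y₀)` as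
soon as it is continuous. The moments of order `r` of `g` and of order `t` of `𝓕 g` say that the
local Fourier coefficients of `Z` are square summable against the weight `1 + |m|^t + |n|^r`. By the
Cauchy–Schwarz inequality, `Z` is then continuous and `Z = o(ε^(1 - 1/r - 1/t))` on the rectangle
`|x - x₀| ≤ ε^(2/t)`, `|y - y₀| ≤ ε^(2/r)`.

Conversely, let `A(x)` and `B(y)` be bumps of height `1` and widths `a` and `b` at `x₀` and `y₀`,
with Fourier coefficients `Aₘ` and `Bₙ`. The function `∑ Aₘ Bₙ e^{2πimx} g(x - n)` has the `L²` norm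
of `A B Z` over a unit square, which is at most `2 √(ab) sup |Z|`, the supremum being over the
rectangle; but its coefficients have `ℓ^q` norm at least a multiple of `(ab)^(1 - 1/q)`. In an exact
`(C_q)`-system coefficients are determined by the function, and their `ℓ^q` norm is bounded by its
norm. Thus `(ab)^(1 - 1/q) ≲ √(ab) sup |Z|`. When `1/r + 1/t = q'/2`, the choice `a = ε^(2/t)`,
`b = ε^(2/r)` makes the left side a multiple of `ε` and the right side `o(ε)`.

The Cauchy–Schwarz step needs `t (1 - 1/r) < 3` and `r (1 - 1/t) < 3`; the lower bound
`4(q - 1)/(q + 2)` on both exponents is what allows them to be decreased to a pair with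
`1/r + 1/t = q'/2` that satisfies these inequalities.
-/

noncomputable section

open Asymptotics Filter
open scoped Topology SchwartzMap ContDiff

section LatticeSums

theorem summable_int_and_tsum_le_integral {f : ℤ → ℝ} {h : ℝ → ℝ} (hf : ∀ n, 0 ≤ f n)
    (hh : Integrable h) (hle : ∀ (n : ℤ) (x : ℝ), |x - n| ≤ 1 / 2 → f n ≤ h x) :
    Summable f ∧ ∑' n, f n ≤ ∫ x, h x := by
  have hsum := hh.hasSum_intervalIntegral (-1 / 2)
  have hterm (n : ℤ) : f n ≤ ∫ x in (-1 / 2 + n : ℝ)..(-1 / 2 + n + 1), h x := by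
    have hmono := intervalIntegral.integral_mono_on (μ := volume)
      (by linarith : (-1 / 2 + n : ℝ) ≤ -1 / 2 + n + 1) intervalIntegrable_const
      hh.intervalIntegrable
      fun x hx => hle n x (abs_le.2 ⟨by linarith [hx.1], by linarith [hx.2]⟩)
    rwa [intervalIntegral.integral_const, add_sub_cancel_left, one_smul] at hmono
  have hsf : Summable f := .of_nonneg_of_le hf hterm hsum.summable
  exact ⟨hsf, (hsf.tsum_le_tsum hterm hsum.summable).trans_eq hsum.tsum_eq⟩

theorem integrable_inv_one_add_abs_rpow {r : ℝ} (hr : 1 < r) :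
    Integrable fun u : ℝ => (1 + |u| ^ r)⁻¹ := by
  have hdom : Integrable fun u : ℝ => 2 ^ r * (1 + ‖u‖) ^ (-r) :=
    (integrable_one_add_norm (by simpa using hr)).const_mul _
  refine hdom.mono' (Measurable.aestronglyMeasurable (by fun_prop)) (.of_forall fun u => ?_)
  have hu : (1 + |u|) ^ r ≤ 2 ^ r * (1 + |u| ^ r) := calc
    (1 + |u|) ^ r ≤ (2 * max 1 |u|) ^ r := by
      gcongr
      linarith [le_max_left 1 |u|, le_max_right 1 |u|]
    _ = 2 ^ r * max 1 |u| ^ r := Real.mul_rpow two_pos.le (by positivity)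
    _ ≤ 2 ^ r * (1 + |u| ^ r) := by
      gcongr
      rcases max_choice 1 |u| with h | h <;> rw [h]
      · rw [Real.one_rpow]; linarith [Real.rpow_nonneg (abs_nonneg u) r]
      · linarith
  rw [Real.norm_of_nonneg (by positivity), Real.rpow_neg (by positivity), Real.norm_eq_abs,
    ← div_eq_mul_inv, inv_eq_one_div, div_le_div_iff₀ (by positivity) (by positivity), one_mul]
  exact hu

theorem integrable_min_one_abs_sq_mul_rpow {s : ℝ} (h1 : 1 < s) (h3 : s < 3) :
    Integrable fun u : ℝ => min 1 |u| ^ 2 * |u| ^ (-s) := by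
  have hnear : IntegrableOn (fun u : ℝ => min 1 u ^ 2 * u ^ (-s)) (Set.Ioc 0 1) := by
    have hpow : IntegrableOn (fun u : ℝ => u ^ (2 - s)) (Set.Ioc 0 1) := by
      rw [← intervalIntegrable_iff_integrableOn_Ioc_of_le zero_le_one]
      exact intervalIntegral.intervalIntegrable_rpow' (by linarith)
    refine hpow.congr_fun (fun u hu => ?_) measurableSet_Ioc
    simp only [min_eq_right hu.2, sub_eq_add_neg, Real.rpow_add hu.1, Real.rpow_two]
  have hfar : IntegrableOn (fun u : ℝ => min 1 u ^ 2 * u ^ (-s)) (Set.Ioi 1) := by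
    refine (integrableOn_Ioi_rpow_of_lt (neg_lt_neg h1) one_pos).congr_fun (fun u hu => ?_)
      measurableSet_Ioi
    simp only [min_eq_left (Set.mem_Ioi.1 hu).le, one_pow, one_mul]
  refine (integrable_fun_norm_addHaar volume
    (f := fun u : ℝ => min 1 u ^ 2 * u ^ (-s))).2 ?_
  simpa [Set.Ioc_union_Ioi_eq_Ioi (zero_le_one (α := ℝ))] using hnear.union hfar

theorem add_abs_rpow_le_of_abs_sub_int_le {M r x : ℝ} (hM : 1 ≤ M) (hr : 1 ≤ r) {n : ℤ}
    (hx : |x - n| ≤ 1 / 2) : M + |x| ^ r ≤ 2 ^ r * (M + |(n : ℝ)| ^ r) := by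
  have hr0 : 0 < r := by linarith
  have h2r : 2 ≤ (2 : ℝ) ^ r := by simpa using Real.rpow_le_rpow_of_exponent_le one_le_two hr
  have hxn : |x| ≤ |(n : ℝ)| + 1 / 2 := by linarith [abs_sub_abs_le_abs_sub x n]
  rcases eq_or_ne n 0 with rfl | hn
  · have : |x| ^ r ≤ 1 := Real.rpow_le_one (abs_nonneg x) (by simp at hxn; linarith) hr0.le
    simp only [Int.cast_zero, abs_zero, Real.zero_rpow hr0.ne', add_zero]
    nlinarith
  · have hn1 : (1 : ℝ) ≤ |(n : ℝ)| := mod_cast Int.one_le_abs hn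
    have : |x| ^ r ≤ 2 ^ r * |(n : ℝ)| ^ r := by
      rw [← Real.mul_rpow two_pos.le (abs_nonneg _)]
      gcongr
      linarith
    nlinarith

theorem exists_tsum_inv_add_abs_rpow_le {r : ℝ} (hr : 1 < r) :
    ∃ C : ℝ, ∀ M : ℝ, 1 ≤ M → (Summable fun n : ℤ => (M + |(n : ℝ)| ^ r)⁻¹) ∧
      ∑' n : ℤ, (M + |(n : ℝ)| ^ r)⁻¹ ≤ C * M ^ (1 / r - 1) := by
  refine ⟨2 ^ r * ∫ u : ℝ, (1 + |u| ^ r)⁻¹, fun M hM => ?_⟩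
  have hM0 : 0 < M := by linarith
  have hr0 : 0 < r := by linarith
  set b : ℝ := M ^ (-(1 / r)) with hb
  have hb0 : 0 < b := by positivity
  have hbr : b ^ r = M⁻¹ := by
    rw [hb, ← Real.rpow_mul hM0.le, neg_mul, one_div_mul_cancel hr0.ne', Real.rpow_neg_one]
  have hscale (x : ℝ) : 2 ^ r * M⁻¹ * (1 + |b * x| ^ r)⁻¹ = 2 ^ r * (M + |x| ^ r)⁻¹ := by
    rw [abs_mul, Real.mul_rpow (abs_nonneg b) (abs_nonneg x), abs_of_pos hb0, hbr]
    field_simp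
  have hint := ((integrable_inv_one_add_abs_rpow hr).comp_mul_left' hb0.ne').const_mul
    (2 ^ r * M⁻¹)
  have hsum := summable_int_and_tsum_le_integral (f := fun n : ℤ => (M + |(n : ℝ)| ^ r)⁻¹)
    (fun n => by positivity) hint fun n x hx => by
      rw [hscale, ← div_eq_mul_inv, inv_eq_one_div,
        div_le_div_iff₀ (by positivity) (by positivity), one_mul]
      exact add_abs_rpow_le_of_abs_sub_int_le hM hr.le hx
  refine ⟨hsum.1, hsum.2.trans_eq ?_⟩
  rw [integral_const_mul, Measure.integral_comp_mul_left (fun u : ℝ => (1 + |u| ^ r)⁻¹) b,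
    abs_of_pos (inv_pos.2 hb0), smul_eq_mul, hb, Real.rpow_neg hM0.le, inv_inv,
    Real.rpow_sub hM0, Real.rpow_one]
  field_simp

theorem min_one_abs_mul_sq_mul_rpow_le_of_abs_sub_int_le {a s x : ℝ} (ha : 0 < a) (hs : 0 < s)
    {n : ℤ} (hx : |x - n| ≤ 1 / 2) :
    min 1 (|(n : ℝ)| * a) ^ 2 * |(n : ℝ)| ^ (-s)
      ≤ (2 * min 1 (|x| * a)) ^ 2 * (2 ^ s * |x| ^ (-s)) := by
  rcases eq_or_ne n 0 with rfl | hn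
  · rw [Int.cast_zero, abs_zero, zero_mul, min_eq_right zero_le_one, zero_pow two_ne_zero, zero_mul]
    positivity
  have hn1 : (1 : ℝ) ≤ |(n : ℝ)| := mod_cast Int.one_le_abs hn
  have hnx : |(n : ℝ)| ≤ 2 * |x| := by
    linarith [abs_sub_abs_le_abs_sub (n : ℝ) x, abs_sub_comm x n]
  have hxn : |x| ≤ 2 * |(n : ℝ)| := by linarith [abs_sub_abs_le_abs_sub x n]
  have hx0 : 0 < |x| := by linarith
  gcongr
  · rw [mul_min_of_nonneg _ _ two_pos.le]
    exact min_le_min (by norm_num) (by nlinarith)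
  · calc |(n : ℝ)| ^ (-s) ≤ (2⁻¹ * |x|) ^ (-s) :=
          Real.rpow_le_rpow_of_nonpos (by positivity) (by linarith) (by linarith)
      _ = 2 ^ s * |x| ^ (-s) := by
          rw [Real.mul_rpow (by positivity) hx0.le, Real.inv_rpow two_pos.le,
            Real.rpow_neg two_pos.le, inv_inv]

theorem exists_tsum_min_one_abs_mul_sq_mul_rpow_le {s : ℝ} (h1 : 1 < s) (h3 : s < 3) :
    ∃ C : ℝ, ∀ a : ℝ, 0 < a →
      (Summable fun m : ℤ => min 1 (|(m : ℝ)| * a) ^ 2 * |(m : ℝ)| ^ (-s)) ∧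
      ∑' m : ℤ, min 1 (|(m : ℝ)| * a) ^ 2 * |(m : ℝ)| ^ (-s) ≤ C * a ^ (s - 1) := by
  refine ⟨4 * 2 ^ s * ∫ u : ℝ, min 1 |u| ^ 2 * |u| ^ (-s), fun a ha => ?_⟩
  have hscale (x : ℝ) : 4 * 2 ^ s * a ^ s * (min 1 |a * x| ^ 2 * |a * x| ^ (-s))
      = (2 * min 1 (|x| * a)) ^ 2 * (2 ^ s * |x| ^ (-s)) := by
    rw [abs_mul, abs_of_pos ha, Real.mul_rpow ha.le (abs_nonneg x), Real.rpow_neg ha.le,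
      mul_comm |x| a]
    field_simp
    ring
  have hint := ((integrable_min_one_abs_sq_mul_rpow h1 h3).comp_mul_left' ha.ne').const_mul
    (4 * 2 ^ s * a ^ s)
  have hsum := summable_int_and_tsum_le_integral
    (f := fun m : ℤ => min 1 (|(m : ℝ)| * a) ^ 2 * |(m : ℝ)| ^ (-s))
    (fun n => by positivity) hint fun n x hx =>
      (min_one_abs_mul_sq_mul_rpow_le_of_abs_sub_int_le ha (by linarith) hx).trans_eq
        (hscale x).symm
  refine ⟨hsum.1, hsum.2.trans_eq ?_⟩
  rw [integral_const_mul, Measure.integral_comp_mul_left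
    (fun u : ℝ => min 1 |u| ^ 2 * |u| ^ (-s)) a, abs_of_pos (inv_pos.2 ha), smul_eq_mul,
    Real.rpow_sub ha, Real.rpow_one]
  ring

end LatticeSums

section WeightedSeries

variable {ι α : Type*}

theorem summable_mul_and_tsum_le_sqrt_mul_sqrt {c u w : ι → ℝ} (hc : ∀ i, 0 ≤ c i)
    (hu : ∀ i, 0 ≤ u i) (hw : ∀ i, 0 < w i) (hcw : Summable fun i => c i ^ 2 * w i)
    (huw : Summable fun i => u i ^ 2 / w i) :
    (Summable fun i => c i * u i) ∧
      ∑' i, c i * u i ≤ √(∑' i, c i ^ 2 * w i) * √(∑' i, u i ^ 2 / w i) := by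
  have hcsq (i : ι) : (c i * √(w i)) ^ (2 : ℝ) = c i ^ 2 * w i := by
    rw [Real.rpow_two, mul_pow, Real.sq_sqrt (hw i).le]
  have husq (i : ι) : (u i / √(w i)) ^ (2 : ℝ) = u i ^ 2 / w i := by
    rw [Real.rpow_two, div_pow, Real.sq_sqrt (hw i).le]
  have hprod (i : ι) : c i * √(w i) * (u i / √(w i)) = c i * u i := by
    have := Real.sqrt_pos.2 (hw i)
    field_simp
  simpa only [hcsq, husq, hprod, ← Real.sqrt_eq_rpow] using
    Real.summable_and_inner_le_Lp_mul_Lq_tsum_of_nonneg Real.HolderConjugate.two_two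
      (fun i => mul_nonneg (hc i) (Real.sqrt_nonneg (w i)))
      (fun i => div_nonneg (hu i) (Real.sqrt_nonneg (w i)))
      (by simpa only [hcsq] using hcw) (by simpa only [husq] using huw)

theorem isLittleO_tsum_mul_of_weighted {l : Filter α} {c w : ι → ℝ} {u : α → ι → ℝ} {ρ : α → ℝ}
    {C : ℝ} (hc : ∀ i, 0 ≤ c i) (hw : ∀ i, 0 < w i) (hcw : Summable fun i => c i ^ 2 * w i)
    (hu : ∀ᶠ x in l, ∀ i, 0 ≤ u x i)
    (huw : ∀ᶠ x in l, (Summable fun i => u x i ^ 2 / w i) ∧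
      ∑' i, u x i ^ 2 / w i ≤ C * ρ x ^ 2)
    (hterm : ∀ i, (fun x => u x i) =o[l] ρ) :
    (fun x => ∑' i, c i * u x i) =o[l] ρ := by
  refine IsLittleO.of_bound fun δ hδ => ?_
  obtain ⟨T, hT⟩ : ∃ T : Finset ι, √(∑' i : {i // i ∉ T}, c i ^ 2 * w i) * √C ≤ δ / 2 := by
    have hlim : Tendsto (fun T : Finset ι => √(∑' i : {i // i ∉ T}, c i ^ 2 * w i) * √C)
        atTop (𝓝 0) := by
      simpa using ((Real.continuous_sqrt.tendsto 0).comp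
        (tendsto_tsum_compl_atTop_zero fun i => c i ^ 2 * w i)).mul_const (√C)
    exact (hlim.eventually_le_const (half_pos hδ)).exists
  have hfinite : (fun x => ∑ i ∈ T, c i * u x i) =o[l] ρ :=
    .fun_sum fun i _ => (hterm i).const_mul_left (c i)
  filter_upwards [hu, huw, hfinite.bound (half_pos hδ)] with x hu ⟨hsum, hle⟩ hfin
  have hcu := (summable_mul_and_tsum_le_sqrt_mul_sqrt hc hu hw hcw hsum).1
  have htail : ∑' i : {i // i ∉ T}, c i * u x i ≤ δ / 2 * ‖ρ x‖ := calc
    _ ≤ √(∑' i : {i // i ∉ T}, c i ^ 2 * w i) * √(∑' i : {i // i ∉ T}, u x i ^ 2 / w i) :=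
      (summable_mul_and_tsum_le_sqrt_mul_sqrt (ι := {i // i ∉ T}) (fun i => hc i)
        (fun i => hu i) (fun i => hw i) (hcw.subtype {i | i ∉ T}) (hsum.subtype {i | i ∉ T})).2
    _ ≤ √(∑' i : {i // i ∉ T}, c i ^ 2 * w i) * √(C * ρ x ^ 2) := by
      gcongr
      exact (hsum.tsum_subtype_le _ _ fun i => div_nonneg (sq_nonneg _) (hw i).le).trans hle
    _ = √(∑' i : {i // i ∉ T}, c i ^ 2 * w i) * √C * ‖ρ x‖ := by
      rw [Real.sqrt_mul' C (sq_nonneg _), Real.sqrt_sq_eq_abs, mul_assoc, Real.norm_eq_abs]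
    _ ≤ δ / 2 * ‖ρ x‖ := by gcongr
  rw [Real.norm_of_nonneg (tsum_nonneg fun i => mul_nonneg (hc i) (hu i)),
    ← hcu.sum_add_tsum_subtype_compl T]
  linarith [Real.le_norm_self (∑ i ∈ T, c i * u x i)]

/-- The weight `1 + |m|^t + |n|^r` on `ℤ²`. The local Fourier coefficients of a Zak transform are
square summable against it when the function and its Fourier transform have finite moments of
orders `r` and `t`. -/
def latticeWeight (t r : ℝ) (p : ℤ × ℤ) : ℝ :=
  1 + |(p.1 : ℝ)| ^ t + |(p.2 : ℝ)| ^ r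

theorem latticeWeight_pos (t r : ℝ) (p : ℤ × ℤ) : 0 < latticeWeight t r p := by
  unfold latticeWeight
  positivity

theorem latticeWeight_swap (t r : ℝ) (p : ℤ × ℤ) :
    latticeWeight t r p.swap = latticeWeight r t p := by
  simp only [latticeWeight, Prod.fst_swap, Prod.snd_swap]
  ring

theorem exists_tsum_div_latticeWeight_le {r : ℝ} (hr : 1 < r) (t : ℝ) :
    ∃ C : ℝ, 0 ≤ C ∧ ∀ φ : ℤ → ℝ, (∀ m, 0 ≤ φ m) →
      (Summable fun m : ℤ => φ m * (1 + |(m : ℝ)| ^ t) ^ (1 / r - 1)) →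
      (Summable fun p : ℤ × ℤ => φ p.1 / latticeWeight t r p) ∧
      ∑' p : ℤ × ℤ, φ p.1 / latticeWeight t r p
        ≤ C * ∑' m : ℤ, φ m * (1 + |(m : ℝ)| ^ t) ^ (1 / r - 1) := by
  obtain ⟨C, hC⟩ := exists_tsum_inv_add_abs_rpow_le hr
  have hM (m : ℤ) : (1 : ℝ) ≤ 1 + |(m : ℝ)| ^ t := by
    linarith [Real.rpow_nonneg (abs_nonneg (m : ℝ)) t]
  have hC0 : 0 ≤ C := by
    simpa using (tsum_nonneg fun n : ℤ => by positivity).trans (hC 1 le_rfl).2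
  refine ⟨C, hC0, fun φ hφ hs => ?_⟩
  have hrow (m : ℤ) : Summable fun n : ℤ => φ m / latticeWeight t r (m, n) := by
    simpa only [div_eq_mul_inv, latticeWeight] using (hC _ (hM m)).1.mul_left (φ m)
  have hrowle (m : ℤ) : ∑' n : ℤ, φ m / latticeWeight t r (m, n)
      ≤ C * (φ m * (1 + |(m : ℝ)| ^ t) ^ (1 / r - 1)) := by
    simp only [div_eq_mul_inv, tsum_mul_left]
    exact (mul_le_mul_of_nonneg_left (hC _ (hM m)).2 (hφ m)).trans_eq (mul_left_comm _ _ _)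
  have hnonneg (p : ℤ × ℤ) : 0 ≤ φ p.1 / latticeWeight t r p :=
    div_nonneg (hφ _) (latticeWeight_pos t r p).le
  have hsum : Summable fun p : ℤ × ℤ => φ p.1 / latticeWeight t r p :=
    (summable_prod_of_nonneg hnonneg).2
      ⟨hrow, .of_nonneg_of_le (fun m => tsum_nonneg fun n => hnonneg (m, n)) hrowle
        (hs.mul_left C)⟩
  refine ⟨hsum, ?_⟩
  rw [hsum.tsum_prod, ← tsum_mul_left]
  exact hsum.prod.tsum_le_tsum hrowle (hs.mul_left C)

theorem one_add_abs_rpow_rpow_le {r t : ℝ} (hr : 1 ≤ r) {m : ℤ} (hm : m ≠ 0) :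
    (1 + |(m : ℝ)| ^ t) ^ (1 / r - 1) ≤ |(m : ℝ)| ^ (-(t * (1 - 1 / r))) := by
  have hm0 : 0 < |(m : ℝ)| := by positivity
  have hr1 : 1 / r ≤ 1 := (div_le_one (by linarith)).2 hr
  rw [show -(t * (1 - 1 / r)) = t * (1 / r - 1) by ring, Real.rpow_mul hm0.le]
  exact Real.rpow_le_rpow_of_nonpos (by positivity) (by linarith) (by linarith)

theorem exists_tsum_min_one_sq_div_latticeWeight_le {r t : ℝ} (hr : 1 < r)
    (h1 : 1 < t * (1 - 1 / r)) (h3 : t * (1 - 1 / r) < 3) :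
    ∃ C : ℝ, ∀ a : ℝ, 0 < a →
      (Summable fun p : ℤ × ℤ => min 1 (|(p.1 : ℝ)| * a) ^ 2 / latticeWeight t r p) ∧
      ∑' p : ℤ × ℤ, min 1 (|(p.1 : ℝ)| * a) ^ 2 / latticeWeight t r p
        ≤ C * a ^ (t * (1 - 1 / r) - 1) := by
  obtain ⟨C, hC0, hC⟩ := exists_tsum_div_latticeWeight_le hr t
  obtain ⟨D, hD⟩ := exists_tsum_min_one_abs_mul_sq_mul_rpow_le h1 h3
  refine ⟨C * D, fun a ha => ?_⟩
  have hle (m : ℤ) : min 1 (|(m : ℝ)| * a) ^ 2 * (1 + |(m : ℝ)| ^ t) ^ (1 / r - 1)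
      ≤ min 1 (|(m : ℝ)| * a) ^ 2 * |(m : ℝ)| ^ (-(t * (1 - 1 / r))) := by
    rcases eq_or_ne m 0 with rfl | hm
    · simp
    · gcongr
      exact one_add_abs_rpow_rpow_le hr.le hm
  have hs := Summable.of_nonneg_of_le (fun m => by positivity) hle (hD a ha).1
  have hsum := hC (fun m => min 1 (|(m : ℝ)| * a) ^ 2) (fun m => by positivity) hs
  refine ⟨hsum.1, hsum.2.trans ?_⟩
  rw [mul_assoc]
  gcongr
  exact (hs.tsum_le_tsum hle (hD a ha).1).trans (hD a ha).2

theorem summable_inv_latticeWeight {r t : ℝ} (hr : 1 < r) (h1 : 1 < t * (1 - 1 / r)) :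
    Summable fun p : ℤ × ℤ => (latticeWeight t r p)⁻¹ := by
  obtain ⟨C, -, hC⟩ := exists_tsum_div_latticeWeight_le hr t
  have hpow : Summable fun m : ℤ => |(m : ℝ)| ^ (-(t * (1 - 1 / r))) :=
    Real.summable_abs_int_rpow h1
  have hrow : Summable fun m : ℤ => (1 : ℝ) * (1 + |(m : ℝ)| ^ t) ^ (1 / r - 1) := by
    refine hpow.of_norm_bounded_eventually ?_
    filter_upwards [(Set.finite_singleton (0 : ℤ)).compl_mem_cofinite] with m hm
    rw [one_mul, Real.norm_of_nonneg (by positivity)]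
    exact one_add_abs_rpow_rpow_le hr.le hm
  simpa only [one_div] using (hC (fun _ => 1) (fun _ => zero_le_one) hrow).1

theorem summable_norm_of_latticeWeight {r t : ℝ} (hr : 1 < r) (h1 : 1 < t * (1 - 1 / r))
    {c : ℤ × ℤ → ℂ} (hc : Summable fun p => ‖c p‖ ^ 2 * latticeWeight t r p) :
    Summable fun p => ‖c p‖ := by
  simpa using (summable_mul_and_tsum_le_sqrt_mul_sqrt (u := fun _ => (1 : ℝ))
    (fun p => norm_nonneg (c p)) (fun _ => zero_le_one) (latticeWeight_pos t r) hc
    (by simpa using summable_inv_latticeWeight hr h1)).1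

theorem tendsto_rpow_nhdsGT_zero {s : ℝ} (hs : 0 < s) :
    Tendsto (fun ε : ℝ => ε ^ s) (𝓝[>] 0) (𝓝 0) := by
  have h := (Real.continuousAt_rpow_const 0 s (.inr hs.le)).tendsto
  rw [Real.zero_rpow hs.ne'] at h
  exact h.mono_left nhdsWithin_le_nhds

theorem isLittleO_min_one_mul_rpow {α β : ℝ} (x : ℝ) (h : α < β) :
    (fun ε => min 1 (|x| * ε ^ β)) =o[𝓝[>] 0] (fun ε : ℝ => ε ^ α) := by
  have hpow : (fun ε : ℝ => ε ^ β) =o[𝓝[>] 0] (fun ε : ℝ => ε ^ α) := by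
    refine isLittleO_of_tendsto' ?_ ?_
    · filter_upwards [self_mem_nhdsWithin] with ε (hε : 0 < ε) h0
      exact absurd h0 (Real.rpow_pos_of_pos hε α).ne'
    · refine (tendsto_rpow_nhdsGT_zero (sub_pos.2 h)).congr' ?_
      filter_upwards [self_mem_nhdsWithin] with ε hε
      exact Real.rpow_sub hε β α
  refine IsBigO.trans_isLittleO (.of_bound 1 ?_) (hpow.const_mul_left |x|)
  filter_upwards [self_mem_nhdsWithin] with ε (hε : 0 < ε)
  rw [one_mul, Real.norm_of_nonneg (by positivity), Real.norm_of_nonneg (by positivity)]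
  exact min_le_right _ _

theorem isLittleO_tsum_norm_mul_min_one {r t : ℝ} (hr : 1 < r) (ht : 0 < t)
    (h1 : 1 < t * (1 - 1 / r)) (h3 : t * (1 - 1 / r) < 3) {c : ℤ × ℤ → ℂ}
    (hc : Summable fun p => ‖c p‖ ^ 2 * latticeWeight t r p) :
    (fun ε => ∑' p, ‖c p‖ * min 1 (|(p.1 : ℝ)| * ε ^ (2 / t)))
      =o[𝓝[>] 0] (fun ε : ℝ => ε ^ (1 - 1 / r - 1 / t)) := by
  obtain ⟨C, hC⟩ := exists_tsum_min_one_sq_div_latticeWeight_le hr h1 h3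
  have hexp : 1 - 1 / r - 1 / t < 2 / t := by
    have : (2 / t - (1 - 1 / r - 1 / t)) * t = 3 - t * (1 - 1 / r) := by field_simp; ring
    nlinarith
  refine isLittleO_tsum_mul_of_weighted (C := C) (fun p => norm_nonneg (c p))
    (latticeWeight_pos t r) hc ?_ ?_ fun p => isLittleO_min_one_mul_rpow _ hexp
  · filter_upwards [self_mem_nhdsWithin] with ε (hε : 0 < ε) p
    positivity
  · filter_upwards [self_mem_nhdsWithin] with ε (hε : 0 < ε)
    refine ⟨(hC _ (by positivity)).1, (hC _ (by positivity)).2.trans_eq ?_⟩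
    rw [← Real.rpow_mul hε.le, ← Real.rpow_natCast, ← Real.rpow_mul hε.le]
    congr 2
    field_simp
    ring

end WeightedSeries

section MinimalSystems

open Finsupp (linearCombination)

variable {ι H : Type*} [NormedAddCommGroup H] [InnerProductSpace ℂ H]

theorem IsMinimalSystem.exists_coeff_bound {f : ι → H} (hf : IsMinimalSystem f) (i : ι) :
    ∃ d : ℝ, 0 < d ∧ ∀ a : ι →₀ ℂ, d * ‖a i‖ ≤ ‖linearCombination ℂ f a‖ := by
  classical
  set V := (Submodule.span ℂ (f '' {j | j ≠ i})).topologicalClosure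
  have hpos : 0 < Metric.infDist (f i) V :=
    ((Submodule.isClosed_topologicalClosure _).notMem_iff_infDist_pos ⟨0, V.zero_mem⟩).1 (hf i)
  refine ⟨_, hpos, fun a => ?_⟩
  rcases eq_or_ne (a i) 0 with hi | hi
  · simp [hi]
  set v := linearCombination ℂ f (a.erase i)
  have hvV : v ∈ V := by
    refine Submodule.le_topologicalClosure _ ((Finsupp.mem_span_image_iff_linearCombination ℂ).2
      ⟨a.erase i, ?_, rfl⟩)
    rw [Finsupp.mem_supported, Finsupp.support_erase]
    exact fun j hj => Finset.ne_of_mem_erase hj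
  have hsplit : linearCombination ℂ f a = a i • (f i - (-(a i)⁻¹ • v)) := by
    conv_lhs => rw [← Finsupp.single_add_erase i a]
    simp [v, smul_smul, hi]
  rw [hsplit, norm_smul, mul_comm, ← dist_eq_norm]
  gcongr
  exact Metric.infDist_le_dist_of_mem (V.smul_mem _ hvV)

theorem IsMinimalSystem.tendsto_coeff {α : Type*} {l : Filter α} {f : ι → H}
    (hf : IsMinimalSystem f) {b : α → ι →₀ ℂ} {a : ι →₀ ℂ}
    (h : Tendsto (fun n => linearCombination ℂ f (b n)) l (𝓝 (linearCombination ℂ f a))) (i : ι) :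
    Tendsto (fun n => b n i) l (𝓝 (a i)) := by
  obtain ⟨d, hd, hbound⟩ := hf.exists_coeff_bound i
  rw [tendsto_iff_norm_sub_tendsto_zero] at h ⊢
  refine squeeze_zero (fun _ => norm_nonneg _) (fun n => ?_) (by simpa using h.const_mul d⁻¹)
  rw [inv_mul_eq_div, le_div_iff₀ hd, mul_comm, ← map_sub]
  exact hbound (b n - a)

theorem sum_norm_rpow_le_finiteLqNorm_rpow {q : ℝ} (hq : 0 < q) (a : ι →₀ ℂ) (s : Finset ι) :
    ∑ i ∈ s, ‖a i‖ ^ q ≤ finiteLqNorm q a ^ q := by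
  classical
  rw [finiteLqNorm, ← Real.rpow_mul (Finset.sum_nonneg fun _ _ => by positivity),
    one_div_mul_cancel hq.ne', Real.rpow_one]
  calc ∑ i ∈ s, ‖a i‖ ^ q ≤ ∑ i ∈ s ∪ a.support, ‖a i‖ ^ q :=
        Finset.sum_le_sum_of_subset_of_nonneg Finset.subset_union_left fun _ _ _ => by positivity
    _ = ∑ i ∈ a.support, ‖a i‖ ^ q := by
        refine (Finset.sum_subset Finset.subset_union_right fun i _ hi => ?_).symm
        rw [Finsupp.notMem_support_iff.1 hi, norm_zero, Real.zero_rpow hq.ne']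

theorem IsCqSystem.exists_sum_norm_rpow_le {f : ι → H} {q : ℝ} (hq : 0 < q)
    (hcq : IsCqSystem q f) (hmin : IsMinimalSystem f) :
    ∃ C : ℝ, 0 < C ∧ ∀ (s : Finset ι) (c : ι → ℂ),
      ∑ i ∈ s, ‖c i‖ ^ q ≤ (C * ‖∑ i ∈ s, c i • f i‖) ^ q := by
  classical
  obtain ⟨C, hC, happrox⟩ := hcq
  refine ⟨C, hC, fun s c => ?_⟩
  set a : ι →₀ ℂ := ∑ i ∈ s, Finsupp.single i (c i)
  have hac (i : ι) (hi : i ∈ s) : a i = c i := by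
    simp [a, Finsupp.single_apply, hi]
  have hlin : linearCombination ℂ f a = ∑ i ∈ s, c i • f i := by
    simp [a]
  choose b hb hbq using fun n : ℕ => happrox (linearCombination ℂ f a) (1 / (n + 1)) (by positivity)
  have hblim : Tendsto (fun n => linearCombination ℂ f (b n)) atTop
      (𝓝 (linearCombination ℂ f a)) := by
    rw [tendsto_iff_norm_sub_tendsto_zero]
    exact squeeze_zero (fun _ => norm_nonneg _)
      (fun n => (norm_sub_rev _ _).trans_le (hb n).le) tendsto_one_div_add_atTop_nhds_zero_nat
  have hcoeff (i : ι) (hi : i ∈ s) : Tendsto (fun n => ‖b n i‖ ^ q) atTop (𝓝 (‖c i‖ ^ q)) :=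
    hac i hi ▸ ((hmin.tendsto_coeff hblim i).norm.rpow_const (.inr hq.le))
  refine le_of_tendsto' (tendsto_finsetSum s hcoeff) fun n => ?_
  rw [← hlin]
  exact (sum_norm_rpow_le_finiteLqNorm_rpow hq (b n) s).trans
    (Real.rpow_le_rpow (by unfold finiteLqNorm; positivity) (hbq n) hq.le)

theorem IsCqSystem.exists_sum_norm_rpow_le_of_hasSum {f : ι → H} {q : ℝ} (hq : 0 < q)
    (hcq : IsCqSystem q f) (hmin : IsMinimalSystem f) :
    ∃ C : ℝ, 0 < C ∧ ∀ (c : ι → ℂ) (h : H), HasSum (fun i => c i • f i) h →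
      ∀ s : Finset ι, ∑ i ∈ s, ‖c i‖ ^ q ≤ (C * ‖h‖) ^ q := by
  obtain ⟨C, hC, hbound⟩ := hcq.exists_sum_norm_rpow_le hq hmin
  refine ⟨C, hC, fun c h hh s => ?_⟩
  refine ge_of_tendsto ((hh.norm.const_mul C).rpow_const (.inr hq.le)) ?_
  filter_upwards [eventually_ge_atTop s] with S hsS
  exact (Finset.sum_le_sum_of_subset_of_nonneg hsS fun _ _ _ => by positivity).trans (hbound S c)

end MinimalSystems

section FourierSeries

theorem fourierChar_intCast (n : ℤ) : (𝐞 (n : ℝ) : ℂ) = 1 := by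
  rw [Real.fourierChar_apply, Complex.exp_eq_one_iff]
  exact ⟨n, by push_cast; ring⟩

theorem fourierChar_add (x y : ℝ) : (𝐞 (x + y) : ℂ) = 𝐞 x * 𝐞 y := by
  rw [AddChar.map_add_eq_mul, Circle.coe_mul]

theorem fourierChar_int_mul_add_int (m p : ℤ) (x : ℝ) : (𝐞 (m * (x + p)) : ℂ) = 𝐞 (m * x) := by
  rw [mul_add, fourierChar_add, ← Int.cast_mul, fourierChar_intCast, mul_one]

@[fun_prop]
theorem continuous_fourierChar_coe : Continuous fun x : ℝ => (𝐞 x : ℂ) :=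
  continuous_subtype_val.comp Real.continuous_fourierChar

@[simp]
theorem norm_fourierChar_coe (x : ℝ) : ‖(𝐞 x : ℂ)‖ = 1 :=
  Circle.norm_coe _

theorem norm_fourierChar_sub_one_le (x : ℝ) :
    ‖(𝐞 x : ℂ) - 1‖ ≤ 2 * Real.pi * min 1 |x| := by
  rw [mul_min_of_nonneg _ _ Real.two_pi_pos.le]
  refine le_min ((norm_sub_le _ _).trans ?_) ?_
  · rw [norm_fourierChar_coe, norm_one]
    linarith [Real.pi_gt_three]
  · rw [Real.fourierChar_apply, mul_comm]
    refine Real.norm_exp_I_mul_ofReal_sub_one_le.trans_eq ?_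
    rw [Real.norm_eq_abs, abs_mul, abs_of_pos Real.two_pi_pos]

theorem fourier_eq_integral_fourierChar_mul (f : ℝ → ℂ) (w : ℝ) :
    𝓕 f w = ∫ x, (𝐞 (-(w * x)) : ℂ) * f x := by
  simp only [Real.fourier_real_eq, Circle.smul_def, smul_eq_mul, mul_comm w]

theorem fourier_coe_eq_fourierChar {T : ℝ} (hT : T = 1) (n : ℤ) (x : ℝ) :
    fourier n (x : AddCircle T) = (𝐞 (n * x) : ℂ) := by
  subst hT
  rw [fourier_coe_apply, Real.fourierChar_apply]
  congr 1
  push_cast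
  ring

theorem tsum_enorm_sq_intervalIntegral_fourierChar_mul (a : ℝ) {f : ℝ → ℂ}
    (hf : MemLp f 2 (volume.restrict (Set.Ioc a (a + 1)))) :
    ∑' n : ℤ, ‖∫ x in a..a + 1, (𝐞 (-(n * x)) : ℂ) * f x‖ₑ ^ 2
      = ∫⁻ x in Set.Ioc a (a + 1), ‖f x‖ₑ ^ 2 := by
  have hparseval : HasSum (fun n : ℤ => ‖∫ x in a..a + 1, (𝐞 (-(n * x)) : ℂ) * f x‖ ^ 2)
      (∫ x in a..a + 1, ‖f x‖ ^ 2) := by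
    simpa [fourierCoeffOn_eq_integral, fourier_coe_eq_fourierChar (add_sub_cancel_left a 1)]
      using hasSum_sq_fourierCoeffOn (lt_add_one a) hf
  have hint : IntegrableOn (fun x => ‖f x‖ ^ 2) (Set.Ioc a (a + 1)) :=
    (memLp_two_iff_integrable_sq_norm hf.1).1 hf
  have hofReal (z : ℂ) : ‖z‖ₑ ^ 2 = ENNReal.ofReal (‖z‖ ^ 2) := by
    rw [ENNReal.ofReal_pow (norm_nonneg _), ofReal_norm]
  simp only [hofReal]
  rw [← ENNReal.ofReal_tsum_of_nonneg (fun _ => by positivity) hparseval.summable,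
    hparseval.tsum_eq, intervalIntegral.integral_of_le (by linarith),
    ofReal_integral_eq_lintegral_ofReal hint (.of_forall fun _ => by positivity)]

theorem intervalIntegral_fourierChar_int_mul (a : ℝ) (n : ℤ) :
    ∫ x in a..a + 1, (𝐞 (n * x) : ℂ) = if n = 0 then 1 else 0 := by
  split_ifs with hn
  · simp [hn]
  have hc : (2 * Real.pi * n * Complex.I : ℂ) ≠ 0 := by
    simp [hn, Real.pi_ne_zero]
  have hexp (x : ℝ) : (𝐞 (n * x) : ℂ) = Complex.exp (2 * Real.pi * n * Complex.I * x) := by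
    rw [Real.fourierChar_apply]
    congr 1
    push_cast
    ring
  have hperiod := fourierChar_int_mul_add_int n 1 a
  rw [Int.cast_one] at hperiod
  simp only [hexp] at hperiod ⊢
  rw [integral_exp_mul_complex hc, hperiod, sub_self, zero_div]

variable {ι : Type*} {d : ι → ℂ}

theorem summable_mul_fourierChar (hd : Summable d) (φ : ι → ℝ) :
    Summable fun i => d i * (𝐞 (φ i) : ℂ) :=
  .of_norm (by simpa using hd.norm)

theorem continuous_tsum_mul_fourierChar (hd : Summable d) (φ : ι → ℝ) :
    Continuous fun x : ℝ => ∑' i, d i * (𝐞 (φ i * x) : ℂ) :=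
  continuous_tsum (fun i => by fun_prop) hd.norm fun i x => by simp

theorem intervalIntegral_fourierChar_mul_tsum (a : ℝ) {d : ℤ → ℂ} (hd : Summable d) (n : ℤ) :
    ∫ x in a..a + 1, (𝐞 (-(n * x)) : ℂ) * ∑' k : ℤ, d k * (𝐞 (k * x) : ℂ) = d n := by
  have hterm (k : ℤ) (x : ℝ) : (𝐞 (-(n * x)) : ℂ) * (d k * (𝐞 (k * x) : ℂ))
      = d k * (𝐞 ((k - n : ℤ) * x) : ℂ) := by
    rw [show ((k - n : ℤ) * x : ℝ) = -(n * x) + k * x by push_cast; ring, fourierChar_add]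
    ring
  have hdom := intervalIntegral.hasSum_integral_of_dominated_convergence (μ := volume)
    (a := a) (b := a + 1) (F := fun k x => (𝐞 (-(n * x)) : ℂ) * (d k * (𝐞 (k * x) : ℂ)))
    (fun k _ => ‖d k‖) (fun k => (by fun_prop : Continuous _).aestronglyMeasurable)
    (fun k => .of_forall fun x _ => by simp) (.of_forall fun x _ => hd.norm) (by simp)
    (.of_forall fun x _ => (summable_mul_fourierChar hd fun k => k * x).hasSum.mul_left _)
  simp only [hterm, intervalIntegral.integral_const_mul, intervalIntegral_fourierChar_int_mul,
    sub_eq_zero, mul_ite, mul_one, mul_zero] at hdom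
  refine hdom.unique ?_
  simpa using hasSum_single (f := fun k => if k = n then d k else 0) n fun k hk => if_neg hk

theorem tsum_enorm_sq_of_summable (a : ℝ) {d : ℤ → ℂ} (hd : Summable d) :
    ∑' n, ‖d n‖ₑ ^ 2
      = ∫⁻ x in Set.Ioc a (a + 1), ‖∑' k : ℤ, d k * (𝐞 (k * x) : ℂ)‖ₑ ^ 2 := by
  have hmem : MemLp (fun x : ℝ => ∑' k : ℤ, d k * (𝐞 (k * x) : ℂ)) 2
      (volume.restrict (Set.Ioc a (a + 1))) :=
    .of_bound (continuous_tsum_mul_fourierChar hd _).aestronglyMeasurable (∑' k, ‖d k‖)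
      (.of_forall fun x => tsum_of_norm_bounded hd.norm.hasSum fun k => by simp)
  simpa only [intervalIntegral_fourierChar_mul_tsum a hd] using
    tsum_enorm_sq_intervalIntegral_fourierChar_mul a hmem

theorem hasSum_mul_of_summable_norm {ι κ R : Type*} [NormedRing R] [CompleteSpace R]
    {u : ι → R} {v : κ → R} (hu : Summable fun i => ‖u i‖) (hv : Summable fun j => ‖v j‖) :
    HasSum (fun p : ι × κ => u p.1 * v p.2) ((∑' i, u i) * ∑' j, v j) :=
  hu.of_norm.hasSum.mul hv.of_norm.hasSum (summable_mul_of_summable_norm hu hv)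

theorem hasSum_tsum_mul_sub {G R : Type*} [AddGroup G] [NormedRing R] [CompleteSpace R]
    {b d : G → R} (hb : Summable fun n => ‖b n‖) (hd : Summable fun n => ‖d n‖) :
    HasSum (fun k => ∑' n, b n * d (k - n)) ((∑' n, b n) * ∑' n, d n) := by
  let e : G × G ≃ G × G := ⟨fun p => (p.2, p.1 - p.2), fun p => (p.2 + p.1, p.1),
    fun p => by simp, fun p => by simp⟩
  have hprod : HasSum (fun p : G × G => b p.2 * d (p.1 - p.2)) ((∑' n, b n) * ∑' n, d n) :=
    e.hasSum_iff.2 (hasSum_mul_of_summable_norm hb hd)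
  exact hprod.prod_fiberwise fun k => (hprod.summable.prod_factor k).hasSum

theorem hasSum_convolution_mul_fourierChar {b d : ℤ → ℂ} (hb : Summable b) (hd : Summable d)
    (y : ℝ) : HasSum (fun k : ℤ => (∑' n, b n * d (k - n)) * (𝐞 (k * y) : ℂ))
      ((∑' n : ℤ, b n * (𝐞 (n * y) : ℂ)) * ∑' n : ℤ, d n * (𝐞 (n * y) : ℂ)) := by
  have hterm (k n : ℤ) : b n * (𝐞 (n * y) : ℂ) * (d (k - n) * (𝐞 ((k - n : ℤ) * y) : ℂ))
      = b n * d (k - n) * (𝐞 (k * y) : ℂ) := by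
    have hsplit : (k * y : ℝ) = n * y + (k - n : ℤ) * y := by
      push_cast
      ring
    rw [hsplit, fourierChar_add]
    ring
  have h := hasSum_tsum_mul_sub (summable_mul_fourierChar hb fun n : ℤ => n * y).norm
    (summable_mul_fourierChar hd fun n : ℤ => n * y).norm
  simpa only [hterm, tsum_mul_right] using h

theorem hasSum_fourier_mul_fourierChar {f : ℝ → ℂ} (hf : Continuous f) {x₀ x : ℝ}
    (hsupp : ∀ y, 1 / 2 ≤ |y - x₀| → f y = 0) (hsum : Summable fun n : ℤ => 𝓕 f n)
    (hx : |x - x₀| ≤ 1 / 2) :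
    HasSum (fun n : ℤ => 𝓕 f n * (𝐞 (n * x) : ℂ)) (f x) := by
  have hcomp : HasCompactSupport f := .intro (isCompact_closedBall x₀ (1 / 2)) fun y hy =>
    hsupp y (by simpa [Real.dist_eq] using hy : 1 / 2 < |y - x₀|).le
  have hzero : f =ᶠ[cocompact ℝ] 0 :=
    coclosedCompact_eq_cocompact (X := ℝ) ▸ hasCompactSupport_iff_eventuallyEq.1 hcomp
  have hdecay : f =O[cocompact ℝ] fun x => |x| ^ (-2 : ℝ) := hzero.trans_isBigO (isBigO_zero _ _)
  have htranslate : ∑' n : ℤ, f (x + n) = f x := by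
    rw [tsum_eq_single 0 fun n hn => hsupp _ ?_, Int.cast_zero, add_zero]
    have hn1 : (1 : ℝ) ≤ |(n : ℝ)| := mod_cast Int.one_le_abs hn
    have := abs_sub_abs_le_abs_sub (n : ℝ) (-(x - x₀))
    rw [abs_neg, sub_neg_eq_add, show n + (x - x₀) = x + n - x₀ by ring] at this
    linarith
  have hpoisson := Real.tsum_eq_tsum_fourier_of_rpow_decay_of_summable hf one_lt_two hdecay hsum x
  simp only [fourier_coe_eq_fourierChar rfl, htranslate] at hpoisson
  exact hpoisson ▸ (summable_mul_fourierChar hsum fun n : ℤ => n * x).hasSum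

end FourierSeries

section WeightedEnergy

theorem ennreal_tsum_mul_sq_le {ι : Type*} (a b : ι → ℝ≥0∞) :
    (∑' i, a i * b i) ^ 2 ≤ (∑' i, a i ^ 2) * ∑' i, b i ^ 2 := by
  let _ : MeasurableSpace ι := ⊤
  have h := ENNReal.lintegral_mul_le_Lp_mul_Lq (Measure.count : Measure ι)
    Real.HolderConjugate.two_two (f := a) (g := b)
    measurable_from_top.aemeasurable measurable_from_top.aemeasurable
  simp only [Pi.mul_apply, lintegral_count, ENNReal.rpow_ofNat] at h
  refine (pow_le_pow_left' h 2).trans_eq ?_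
  rw [mul_pow, ← ENNReal.rpow_mul_natCast, ← ENNReal.rpow_mul_natCast]
  norm_num

theorem one_add_enorm_ne_top (x : ℝ) : 1 + ‖x‖ₑ ≠ ⊤ := by finiteness

theorem one_add_enorm_le_mul (x y : ℝ) : 1 + ‖x‖ₑ ≤ (1 + ‖y‖ₑ) * (1 + ‖x - y‖ₑ) := calc
  1 + ‖x‖ₑ ≤ 1 + (‖y‖ₑ + ‖x - y‖ₑ) := by
    gcongr
    simpa using enorm_add_le y (x - y)
  _ ≤ 1 + (‖y‖ₑ + ‖x - y‖ₑ) + ‖y‖ₑ * ‖x - y‖ₑ := le_self_add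
  _ = _ := by ring

theorem one_add_enorm_le_two_mul {x y : ℝ} (h : |x - y| ≤ 1) : 1 + ‖x‖ₑ ≤ 2 * (1 + ‖y‖ₑ) := by
  have hxy : ‖x - y‖ₑ ≤ 1 := by
    rw [Real.enorm_eq_ofReal_abs]
    exact ENNReal.ofReal_le_one.2 h
  calc 1 + ‖x‖ₑ ≤ (1 + ‖y‖ₑ) * (1 + ‖x - y‖ₑ) := one_add_enorm_le_mul x y
    _ ≤ (1 + ‖y‖ₑ) * (1 + 1) := by gcongr
    _ = _ := by rw [one_add_one_eq_two, mul_comm]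

theorem tsum_inv_one_add_enorm_int_sq_ne_top : ∑' n : ℤ, (1 + ‖(n : ℝ)‖ₑ)⁻¹ ^ 2 ≠ ⊤ := by
  obtain ⟨_, h⟩ := exists_tsum_inv_add_abs_rpow_le one_lt_two
  refine ne_top_of_le_ne_top (h 1 le_rfl).1.tsum_ofReal_ne_top (ENNReal.tsum_le_tsum fun n => ?_)
  rw [ENNReal.ofReal_inv_of_pos (by positivity), ← ENNReal.inv_pow, ENNReal.inv_le_inv,
    Real.enorm_eq_ofReal_abs, ← ENNReal.ofReal_one, ← ENNReal.ofReal_add zero_le_one (abs_nonneg _),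
    ← ENNReal.ofReal_pow (by positivity), Real.rpow_two]
  exact ENNReal.ofReal_le_ofReal (by nlinarith [abs_nonneg (n : ℝ)])

theorem exists_tsum_inv_one_add_enorm_sub_int_sq_le :
    ∃ K : ℝ≥0∞, K ≠ ⊤ ∧ ∀ x : ℝ, ∑' n : ℤ, (1 + ‖x - n‖ₑ)⁻¹ ^ 2 ≤ K := by
  refine ⟨2 ^ 2 * ∑' n : ℤ, (1 + ‖(n : ℝ)‖ₑ)⁻¹ ^ 2,
    ENNReal.mul_ne_top (by finiteness) tsum_inv_one_add_enorm_int_sq_ne_top, fun x => ?_⟩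
  rw [← (Equiv.subLeft ⌊x⌋).tsum_eq fun n : ℤ => (1 + ‖(n : ℝ)‖ₑ)⁻¹ ^ 2, ← ENNReal.tsum_mul_left]
  refine ENNReal.tsum_le_tsum fun n => ?_
  rw [← mul_pow]
  gcongr
  have hfloor : 1 + ‖((⌊x⌋ - n : ℤ) : ℝ)‖ₑ ≤ 2 * (1 + ‖x - n‖ₑ) := by
    refine one_add_enorm_le_two_mul ?_
    rw [abs_le]
    constructor <;> push_cast <;> linarith [Int.floor_le x, Int.lt_floor_add_one x]
  rw [Equiv.subLeft_apply, ← ENNReal.inv_le_inv, inv_inv, ENNReal.mul_inv (by simp) (by simp),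
    inv_inv]
  rw [mul_comm, ← div_eq_mul_inv]
  exact ENNReal.div_le_of_le_mul' hfloor

theorem tsum_setLIntegral_Ioc_add_int (a : ℝ) (f : ℝ → ℝ≥0∞) :
    ∑' k : ℤ, ∫⁻ x in Set.Ioc (a + k) (a + k + 1), f x = ∫⁻ x, f x := by
  rw [← lintegral_iUnion (fun _ => measurableSet_Ioc) (Set.pairwise_disjoint_Ioc_add_intCast a),
    iUnion_Ioc_add_intCast, setLIntegral_univ]

theorem exists_tsum_enorm_fourier_int_sq_le :
    ∃ K : ℝ≥0∞, K ≠ ⊤ ∧ ∀ u : ℝ → ℂ, Integrable u → MemLp u 2 →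
      ∑' n : ℤ, ‖𝓕 u n‖ₑ ^ 2 ≤ K * ∫⁻ x, (1 + ‖x‖ₑ) ^ 2 * ‖u x‖ₑ ^ 2 := by
  set κ : ℝ≥0∞ := ∑' k : ℤ, (1 + ‖(k : ℝ)‖ₑ)⁻¹ ^ 2
  refine ⟨κ * 2 ^ 2, ENNReal.mul_ne_top tsum_inv_one_add_enorm_int_sq_ne_top (by finiteness),
    fun u hu hu2 => ?_⟩
  set c : ℤ → ℤ → ℂ := fun k n => ∫ x in (k : ℝ)..k + 1, (𝐞 (-(n * x)) : ℂ) * u x with hc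
  have hsum (n : ℤ) : ‖𝓕 u n‖ₑ ^ 2 ≤ κ * ∑' k : ℤ, ((1 + ‖(k : ℝ)‖ₑ) * ‖c k n‖ₑ) ^ 2 := by
    have hint : Integrable fun x : ℝ => (𝐞 (-(n * x)) : ℂ) * u x :=
      hu.bdd_mul (c := 1) (by fun_prop : Continuous _).aestronglyMeasurable (by simp)
    have hsplit := hint.hasSum_intervalIntegral 0
    simp only [zero_add] at hsplit
    rw [fourier_eq_integral_fourierChar_mul, ← hsplit.tsum_eq]
    refine (pow_le_pow_left' enorm_tsum_le_tsum_enorm 2).trans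
      (le_trans (le_of_eq ?_) (ennreal_tsum_mul_sq_le _ _))
    congr 2 with k
    rw [← mul_assoc, ENNReal.inv_mul_cancel (by simp) (one_add_enorm_ne_top _), one_mul]
  have hpiece (k : ℤ) : (1 + ‖(k : ℝ)‖ₑ) ^ 2 * ∫⁻ x in Set.Ioc (k : ℝ) (k + 1), ‖u x‖ₑ ^ 2
      ≤ ∫⁻ x in Set.Ioc (k : ℝ) (k + 1), 2 ^ 2 * ((1 + ‖x‖ₑ) ^ 2 * ‖u x‖ₑ ^ 2) := by
    rw [← lintegral_const_mul' _ _ (by finiteness)]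
    refine setLIntegral_mono' measurableSet_Ioc fun x hx => ?_
    rw [← mul_assoc, ← mul_pow 2]
    gcongr
    exact one_add_enorm_le_two_mul (abs_le.2 ⟨by linarith [hx.2], by linarith [hx.1]⟩)
  calc ∑' n : ℤ, ‖𝓕 u n‖ₑ ^ 2
      ≤ ∑' n : ℤ, κ * ∑' k : ℤ, ((1 + ‖(k : ℝ)‖ₑ) * ‖c k n‖ₑ) ^ 2 := ENNReal.tsum_le_tsum hsum
    _ = κ * ∑' k : ℤ, (1 + ‖(k : ℝ)‖ₑ) ^ 2 * ∫⁻ x in Set.Ioc (k : ℝ) (k + 1), ‖u x‖ₑ ^ 2 := by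
      rw [ENNReal.tsum_mul_left, ENNReal.tsum_comm]
      simp only [mul_pow, ENNReal.tsum_mul_left, hc,
        tsum_enorm_sq_intervalIntegral_fourierChar_mul _ (hu2.restrict _)]
    _ ≤ κ * ∑' k : ℤ, ∫⁻ x in Set.Ioc (k : ℝ) (k + 1), 2 ^ 2 * ((1 + ‖x‖ₑ) ^ 2 * ‖u x‖ₑ ^ 2) := by
      gcongr with k
      exact hpiece k
    _ = _ := by
      have hfold := tsum_setLIntegral_Ioc_add_int 0 fun x => 2 ^ 2 * ((1 + ‖x‖ₑ) ^ 2 * ‖u x‖ₑ ^ 2)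
      simp only [zero_add] at hfold
      rw [hfold, lintegral_const_mul' _ _ (by finiteness), mul_assoc]

/-- The samples at frequency `m` and position `n` of the short-time Fourier transform of `f` with
window `w`, the position being moved to the argument of `f`. -/
def windowCoeff (w f : ℝ → ℂ) (m n : ℤ) : ℂ :=
  𝓕 (fun x => w x * f (x + n)) m

theorem exists_rpow_mul_enorm_sq_le (w : 𝓢(ℝ, ℂ)) (s : ℝ) :
    ∃ D : ℝ≥0∞, D ≠ ⊤ ∧ ∀ x, (1 + ‖x‖ₑ) ^ s * ‖w x‖ₑ ^ 2 ≤ D := by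
  obtain ⟨k, hk⟩ := exists_nat_ge s
  obtain ⟨B, hB⟩ : ∃ B : ℝ, ∀ x, (1 + ‖x‖) ^ k * ‖w x‖ ≤ B := by
    have hB := SchwartzMap.one_add_le_sup_seminorm_apply (𝕜 := ℝ) (m := (k, 0)) le_rfl le_rfl w
    simp only [norm_iteratedFDeriv_zero] at hB
    exact ⟨_, hB⟩
  refine ⟨ENNReal.ofReal B ^ 2, by finiteness, fun x => ?_⟩
  have hBx : (1 + ‖x‖ₑ) ^ k * ‖w x‖ₑ ≤ ENNReal.ofReal B := by
    simpa only [ENNReal.ofReal_mul (by positivity : 0 ≤ (1 + ‖x‖) ^ k), ofReal_norm,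
      ENNReal.ofReal_pow (by positivity : 0 ≤ 1 + ‖x‖), ENNReal.ofReal_one,
      ENNReal.ofReal_add zero_le_one (norm_nonneg x)] using ENNReal.ofReal_le_ofReal (hB x)
  calc (1 + ‖x‖ₑ) ^ s * ‖w x‖ₑ ^ 2 ≤ ((1 + ‖x‖ₑ) ^ k) ^ 2 * ‖w x‖ₑ ^ 2 := by
        gcongr
        rw [← pow_mul, ← ENNReal.rpow_natCast]
        exact ENNReal.rpow_le_rpow_of_exponent_le le_self_add (by push_cast; linarith)
    _ ≤ ENNReal.ofReal B ^ 2 := by rw [← mul_pow]; gcongr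

theorem exists_tsum_weight_mul_window_sq_le (w : 𝓢(ℝ, ℂ)) {s : ℝ} (hs : 0 ≤ s) :
    ∃ K : ℝ≥0∞, K ≠ ⊤ ∧ ∀ x : ℝ, ∑' n : ℤ, (1 + ‖(n : ℝ)‖ₑ) ^ s *
      ((1 + ‖x - n‖ₑ) ^ 2 * ‖w (x - n)‖ₑ ^ 2) ≤ K * (1 + ‖x‖ₑ) ^ s := by
  obtain ⟨D, hD, hw⟩ := exists_rpow_mul_enorm_sq_le w (s + 4)
  obtain ⟨K, hK, hsum⟩ := exists_tsum_inv_one_add_enorm_sub_int_sq_le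
  refine ⟨D * K, ENNReal.mul_ne_top hD hK, fun x => ?_⟩
  have hterm (n : ℤ) : (1 + ‖(n : ℝ)‖ₑ) ^ s * ((1 + ‖x - n‖ₑ) ^ 2 * ‖w (x - n)‖ₑ ^ 2)
      ≤ (1 + ‖x‖ₑ) ^ s * (D * (1 + ‖x - n‖ₑ)⁻¹ ^ 2) := by
    have hpeetre : (1 + ‖(n : ℝ)‖ₑ) ^ s ≤ (1 + ‖x‖ₑ) ^ s * (1 + ‖x - n‖ₑ) ^ s := by
      rw [← ENNReal.mul_rpow_of_nonneg _ _ hs, enorm_sub_rev]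
      exact ENNReal.rpow_le_rpow (one_add_enorm_le_mul _ _) hs
    set v := 1 + ‖x - n‖ₑ
    have hv0 : v ≠ 0 := by simp [v]
    have hvt : v ≠ ⊤ := one_add_enorm_ne_top _
    have hv : v ^ s * v ^ 2 = v ^ (s + 4) * v⁻¹ ^ 2 := by
      rw [ENNReal.rpow_add _ _ hv0 hvt, mul_assoc, ENNReal.rpow_ofNat, ← ENNReal.inv_pow,
        show 4 = 2 + 2 from rfl, pow_add, mul_assoc, ENNReal.mul_inv_cancel (pow_ne_zero 2 hv0)
        (ENNReal.pow_ne_top hvt), mul_one]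
    calc (1 + ‖(n : ℝ)‖ₑ) ^ s * (v ^ 2 * ‖w (x - n)‖ₑ ^ 2)
        ≤ (1 + ‖x‖ₑ) ^ s * v ^ s * (v ^ 2 * ‖w (x - n)‖ₑ ^ 2) := by gcongr
      _ = (1 + ‖x‖ₑ) ^ s * (v ^ (s + 4) * ‖w (x - n)‖ₑ ^ 2 * v⁻¹ ^ 2) := by
        rw [mul_right_comm _ _ (v⁻¹ ^ 2), ← hv]
        ring
      _ ≤ _ := by gcongr; exact hw _
  calc _ ≤ ∑' n : ℤ, (1 + ‖x‖ₑ) ^ s * (D * (1 + ‖x - n‖ₑ)⁻¹ ^ 2) := ENNReal.tsum_le_tsum hterm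
    _ ≤ (1 + ‖x‖ₑ) ^ s * (D * K) := by
      rw [ENNReal.tsum_mul_left, ENNReal.tsum_mul_left]
      gcongr
      exact hsum x
    _ = _ := mul_comm _ _

theorem tsum_weight_mul_enorm_windowCoeff_sq_ne_top (w : 𝓢(ℝ, ℂ)) {s : ℝ} (hs : 0 ≤ s) {f : ℝ → ℂ}
    (hf : MemLp f 2) (hfs : ∫⁻ x, (1 + ‖x‖ₑ) ^ s * ‖f x‖ₑ ^ 2 ≠ ⊤) :
    ∑' p : ℤ × ℤ, (1 + ‖(p.2 : ℝ)‖ₑ) ^ s * ‖windowCoeff w f p.1 p.2‖ₑ ^ 2 ≠ ⊤ := by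
  obtain ⟨K, hK, hfourier⟩ := exists_tsum_enorm_fourier_int_sq_le
  obtain ⟨K', hK', hweight⟩ := exists_tsum_weight_mul_window_sq_le w hs
  have hshift (n : ℤ) : MemLp (fun x => f (x + n)) 2 :=
    hf.comp_measurePreserving (measurePreserving_add_right volume (n : ℝ))
  have hrow (n : ℤ) : (1 + ‖(n : ℝ)‖ₑ) ^ s * ∑' m, ‖windowCoeff w f m n‖ₑ ^ 2
      ≤ K * ∫⁻ x : ℝ, (1 + ‖(n : ℝ)‖ₑ) ^ s * ((1 + ‖x - n‖ₑ) ^ 2 * ‖w (x - n)‖ₑ ^ 2) *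
        ‖f x‖ₑ ^ 2 := by
    have hprod := hfourier (fun x => w x * f (x + n)) ((w.memLp 2).integrable_mul (hshift n))
      ((hshift n).mul (w.memLp ⊤))
    rw [← lintegral_sub_right_eq_self _ (n : ℝ)] at hprod
    simp only [sub_add_cancel, enorm_mul, mul_pow] at hprod
    simp only [mul_assoc] at hprod ⊢
    rw [lintegral_const_mul' _ _ (by finiteness), mul_left_comm]
    gcongr
    exact hprod
  have hmeas (n : ℤ) : AEMeasurable fun x : ℝ => (1 + ‖(n : ℝ)‖ₑ) ^ s *
      ((1 + ‖x - n‖ₑ) ^ 2 * ‖w (x - n)‖ₑ ^ 2) * ‖f x‖ₑ ^ 2 := by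
    have hw := w.continuous
    exact (by fun_prop : Measurable _).aemeasurable.mul (hf.1.enorm.pow_const 2)
  refine ne_top_of_le_ne_top (ENNReal.mul_ne_top hK (ENNReal.mul_ne_top hK' hfs)) ?_
  calc ∑' p : ℤ × ℤ, (1 + ‖(p.2 : ℝ)‖ₑ) ^ s * ‖windowCoeff w f p.1 p.2‖ₑ ^ 2
      = ∑' n : ℤ, (1 + ‖(n : ℝ)‖ₑ) ^ s * ∑' m, ‖windowCoeff w f m n‖ₑ ^ 2 := by
        rw [ENNReal.tsum_prod', ENNReal.tsum_comm]
        simp only [ENNReal.tsum_mul_left]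
    _ ≤ ∑' n : ℤ, K * ∫⁻ x : ℝ, (1 + ‖(n : ℝ)‖ₑ) ^ s *
          ((1 + ‖x - n‖ₑ) ^ 2 * ‖w (x - n)‖ₑ ^ 2) * ‖f x‖ₑ ^ 2 := ENNReal.tsum_le_tsum hrow
    _ = K * ∫⁻ x : ℝ, (∑' n : ℤ, (1 + ‖(n : ℝ)‖ₑ) ^ s *
          ((1 + ‖x - n‖ₑ) ^ 2 * ‖w (x - n)‖ₑ ^ 2)) * ‖f x‖ₑ ^ 2 := by
        rw [ENNReal.tsum_mul_left, ← lintegral_tsum hmeas]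
        simp only [ENNReal.tsum_mul_right]
    _ ≤ K * ∫⁻ x, K' * (1 + ‖x‖ₑ) ^ s * ‖f x‖ₑ ^ 2 := by
        gcongr with x
        exact hweight x
    _ = _ := by simp only [mul_assoc, lintegral_const_mul' K' _ hK']

end WeightedEnergy

section TimeFrequency

theorem lintegral_one_add_enorm_rpow_mul_ne_top {s : ℝ} (hs : 0 ≤ s)
    {f : Lp ℂ 2 (volume : Measure ℝ)} (hfs : momentL2 s f ≠ ⊤) :
    ∫⁻ x, (1 + ‖x‖ₑ) ^ s * ‖f x‖ₑ ^ 2 ≠ ⊤ := by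
  set C := ENNReal.LpAddConst (ENNReal.ofReal s)⁻¹
  have hbound (x : ℝ) : (1 + ‖x‖ₑ) ^ s * ‖f x‖ₑ ^ 2
      ≤ C * (‖f x‖ₑ ^ 2 + ENNReal.ofReal (|x| ^ s * ‖f x‖ ^ 2)) := calc
    (1 + ‖x‖ₑ) ^ s * ‖f x‖ₑ ^ 2 ≤ C * (1 ^ s + ‖x‖ₑ ^ s) * ‖f x‖ₑ ^ 2 := by
      gcongr
      exact ENNReal.rpow_add_le_mul_rpow_add_rpow' _ _ hs
    _ = _ := by
      rw [ENNReal.ofReal_mul (by positivity), ENNReal.ofReal_pow (norm_nonneg _), ofReal_norm,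
        ← ENNReal.ofReal_rpow_of_nonneg (abs_nonneg x) hs, ← Real.enorm_eq_ofReal_abs,
        ENNReal.one_rpow]
      ring
  have henergy : ∫⁻ x, ‖f x‖ₑ ^ 2 ≠ ⊤ := by
    simpa using (lintegral_rpow_enorm_lt_top_of_eLpNorm_lt_top two_ne_zero (by simp)
      (Lp.memLp f).2).ne
  refine ne_top_of_le_ne_top ?_ (lintegral_mono hbound)
  rw [lintegral_const_mul' _ _ (ENNReal.LpAddConst_lt_top _).ne,
    lintegral_add_left' ((Lp.memLp f).1.enorm.pow_const 2)]
  exact ENNReal.mul_ne_top (ENNReal.LpAddConst_lt_top _).ne (ENNReal.add_ne_top.2 ⟨henergy, hfs⟩)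

theorem integrable_of_lintegral_one_add_enorm_rpow_mul_ne_top {s : ℝ} (hs : 1 < s) {f : ℝ → ℂ}
    (hf : AEStronglyMeasurable f) (hfs : ∫⁻ x, (1 + ‖x‖ₑ) ^ s * ‖f x‖ₑ ^ 2 ≠ ⊤) :
    Integrable f := by
  have hinv : ∫⁻ x : ℝ, ((1 + ‖x‖ₑ) ^ s)⁻¹ ≠ ⊤ := by
    have h := (finite_integral_one_add_norm (E := ℝ) (μ := volume) (r := s) (by simpa)).ne
    refine ne_of_eq_of_ne (lintegral_congr fun x => ?_) h
    rw [← ENNReal.ofReal_rpow_of_pos (by positivity), ENNReal.rpow_neg,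
      ENNReal.ofReal_add zero_le_one (norm_nonneg x), ENNReal.ofReal_one, ofReal_norm]
  have hbound (x : ℝ) : ‖f x‖ₑ ≤ (1 + ‖x‖ₑ) ^ s * ‖f x‖ₑ ^ 2 + ((1 + ‖x‖ₑ) ^ s)⁻¹ := by
    rcases le_total 1 ((1 + ‖x‖ₑ) ^ s * ‖f x‖ₑ) with h | h
    · refine le_add_right ?_
      simpa only [one_mul, sq, mul_assoc] using mul_le_mul_left h ‖f x‖ₑ
    · exact le_add_left (ENNReal.le_inv_iff_mul_le.2 (by rwa [mul_comm]))
  refine ⟨hf, (lintegral_mono hbound).trans_lt ?_⟩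
  rw [lintegral_add_right _ (by fun_prop)]
  exact ENNReal.add_lt_top.2 ⟨hfs.lt_top, hinv.lt_top⟩

theorem integral_fourier_mul (φ : 𝓢(ℝ, ℂ)) (g : Lp ℂ 2 (volume : Measure ℝ)) :
    ∫ x, (𝓕 φ) x * g x = ∫ ξ, φ ξ * (𝓕 g : Lp ℂ 2 (volume : Measure ℝ)) ξ := by
  have h := congrArg (· φ) (Lp.fourier_toTemperedDistribution_eq g)
  simpa only [TemperedDistribution.fourier_apply, Lp.toTemperedDistribution_apply,
    smul_eq_mul] using h

theorem exists_continuous_ae_eq_of_integrable_fourier {g : Lp ℂ 2 (volume : Measure ℝ)}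
    (hg : Integrable (𝓕 g : Lp ℂ 2 (volume : Measure ℝ))) :
    ∃ G : ℝ → ℂ, Continuous G ∧ g =ᵐ[volume] G := by
  obtain ⟨f, hf⟩ : ∃ f : ℝ → ℂ, f = (𝓕 g : Lp ℂ 2 (volume : Measure ℝ)) := ⟨_, rfl⟩
  rw [← hf] at hg
  have hcont : Continuous (𝓕⁻ f) :=
    VectorFourier.fourierIntegral_continuous Real.continuous_fourierChar (by fun_prop) hg
  refine ⟨𝓕⁻ f, hcont, ae_eq_of_integral_contDiff_smul_eq
    ((Lp.memLp g).locallyIntegrable (by norm_num)) hcont.locallyIntegrable fun φ hφ hφc => ?_⟩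
  obtain ⟨u, hu⟩ : ∃ u : 𝓢(ℝ, ℂ), ∀ x, u x = φ x :=
    ⟨(hφc.comp_left (g := ((↑) : ℝ → ℂ)) (by simp)).toSchwartzMap
      (Complex.ofRealCLM.contDiff.comp hφ), fun _ => rfl⟩
  have hflip : ∫ ξ, 𝓕⁻ u ξ * f ξ = ∫ x, u x * 𝓕⁻ f x := by
    have h := VectorFourier.integral_fourierIntegral_smul_eq_flip (L := -innerₗ ℝ) (μ := volume)
      Real.continuous_fourierChar (by fun_prop) u.integrable hg
    rw [show (-innerₗ ℝ : ℝ →ₗ[ℝ] ℝ →ₗ[ℝ] ℝ).flip = -innerₗ ℝ by ext; simp] at h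
    rw [SchwartzMap.fourierInv_coe]
    exact h
  have hdual := integral_fourier_mul (𝓕⁻ u) g
  rw [FourierTransform.fourier_fourierInv_eq, ← hf, hflip] at hdual
  simpa only [hu, Complex.real_smul] using hdual

theorem windowCoeff_eq_windowCoeff_fourier {w : 𝓢(ℝ, ℂ)} (hw : HasCompactSupport w)
    (g : Lp ℂ 2 (volume : Measure ℝ)) (m n : ℤ) :
    windowCoeff w g m n
      = windowCoeff (𝓕⁻ w : 𝓢(ℝ, ℂ)) (𝓕 g : Lp ℂ 2 (volume : Measure ℝ)) (-n) m := by
  have hsmooth : ContDiff ℝ ∞ fun x : ℝ => (𝐞 (-(m * x)) : ℂ) := by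
    simp only [Real.fourierChar_apply]
    have harg : ContDiff ℝ ∞ fun x : ℝ => 2 * Real.pi * -(m * x) := by fun_prop
    exact ((Complex.ofRealCLM.contDiff.comp harg).mul contDiff_const).cexp
  obtain ⟨v, hv⟩ : ∃ v : 𝓢(ℝ, ℂ), ∀ x, v x = 𝐞 (-(m * x)) * w (x - n) :=
    ⟨((hw.comp_homeomorph (Homeomorph.subRight (n : ℝ))).mul_left).toSchwartzMap
      (hsmooth.mul ((w.smooth _).comp (contDiff_id.sub contDiff_const))), fun _ => rfl⟩
  have hfourier (ξ : ℝ) : 𝓕⁻ v ξ = (𝐞 (n * (ξ - m)) : ℂ) * 𝓕⁻ w (ξ - m) := by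
    rw [SchwartzMap.fourierInv_coe, SchwartzMap.fourierInv_coe, Real.fourierInv_eq,
      Real.fourierInv_eq, ← integral_const_mul, ← integral_add_right_eq_self _ (n : ℝ)]
    refine integral_congr_ae (.of_forall fun x => ?_)
    simp only [Circle.smul_def, smul_eq_mul, hv, add_sub_cancel_right, ← mul_assoc,
      ← fourierChar_add, RCLike.inner_apply, conj_trivial]
    congr 3
    ring
  have hdual := integral_fourier_mul (𝓕⁻ v) g
  rw [FourierTransform.fourier_fourierInv_eq] at hdual
  calc windowCoeff w g m n = ∫ x, v x * g x := by
        rw [windowCoeff, fourier_eq_integral_fourierChar_mul,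
          ← integral_add_right_eq_self (fun x => v x * g x) (n : ℝ)]
        refine integral_congr_ae (.of_forall fun x => ?_)
        simp only [hv, add_sub_cancel_right, ← neg_mul, ← Int.cast_neg,
          fourierChar_int_mul_add_int, mul_assoc]
    _ = ∫ ξ, 𝓕⁻ v ξ * (𝓕 g : Lp ℂ 2 (volume : Measure ℝ)) ξ := hdual
    _ = _ := by
        rw [windowCoeff, fourier_eq_integral_fourierChar_mul,
          ← integral_add_right_eq_self _ (m : ℝ)]
        refine integral_congr_ae (.of_forall fun ξ => ?_)
        simp only [hfourier, add_sub_cancel_right, Int.cast_neg, neg_mul, neg_neg, mul_assoc]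

end TimeFrequency

section ZakTransform

theorem summable_norm_windowCoeff_sq_mul_latticeWeight {r t : ℝ} (hr : 0 ≤ r) (ht : 0 ≤ t)
    {w : 𝓢(ℝ, ℂ)} (hw : HasCompactSupport w) {g : Lp ℂ 2 (volume : Measure ℝ)}
    (hgr : momentL2 r g ≠ ⊤) (hgt : momentL2 t (𝓕 g) ≠ ⊤) :
    Summable fun p : ℤ × ℤ => ‖windowCoeff w g p.1 p.2‖ ^ 2 * latticeWeight t r p := by
  have hposition := tsum_weight_mul_enorm_windowCoeff_sq_ne_top w hr (Lp.memLp g)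
    (lintegral_one_add_enorm_rpow_mul_ne_top hr hgr)
  have hfrequency := tsum_weight_mul_enorm_windowCoeff_sq_ne_top (𝓕⁻ w) ht (Lp.memLp (𝓕 g))
    (lintegral_one_add_enorm_rpow_mul_ne_top ht hgt)
  rw [← ((Equiv.prodComm ℤ ℤ).trans ((Equiv.neg ℤ).prodCongr (Equiv.refl ℤ))).tsum_eq]
    at hfrequency
  simp only [Equiv.trans_apply, Equiv.prodComm_apply, Equiv.prodCongr_apply, Prod.map,
    Prod.fst_swap, Prod.snd_swap, Equiv.neg_apply, Equiv.refl_apply,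
    ← windowCoeff_eq_windowCoeff_fourier hw]
    at hfrequency
  refine .of_nonneg_of_le (fun p => mul_nonneg (sq_nonneg _) (latticeWeight_pos t r p).le)
    (fun p => ?_) (((ENNReal.summable_toReal hfrequency).mul_left 2).add
      (ENNReal.summable_toReal hposition))
  have hweight (x : ℝ) (s : ℝ) : ((1 + ‖x‖ₑ) ^ s).toReal = (1 + |x|) ^ s := by
    rw [← ENNReal.toReal_rpow, ENNReal.toReal_add ENNReal.one_ne_top enorm_ne_top]
    simp
  simp only [ENNReal.toReal_mul, ENNReal.toReal_pow, toReal_enorm, hweight, latticeWeight]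
  have hm : |(p.1 : ℝ)| ^ t ≤ (1 + |(p.1 : ℝ)|) ^ t := by gcongr; linarith
  have hn : |(p.2 : ℝ)| ^ r ≤ (1 + |(p.2 : ℝ)|) ^ r := by gcongr; linarith
  have hone : 1 ≤ (1 + |(p.1 : ℝ)|) ^ t := Real.one_le_rpow (by simp) ht
  nlinarith [sq_nonneg ‖windowCoeff w g p.1 p.2‖]

theorem windowCoeff_congr_ae (w : ℝ → ℂ) {f f' : ℝ → ℂ} (h : f =ᵐ[volume] f') (m n : ℤ) :
    windowCoeff w f m n = windowCoeff w f' m n := by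
  refine Real.fourier_congr_ae ?_ _
  filter_upwards [(measurePreserving_add_right volume (n : ℝ)).quasiMeasurePreserving.ae h]
    with x hx
  rw [hx]

theorem exists_schwartzMap_eq_one_of_abs_le (x₀ : ℝ) : ∃ w : 𝓢(ℝ, ℂ), HasCompactSupport w ∧
    (∀ x, |x - x₀| ≤ 1 / 8 → w x = 1) ∧ ∀ x, 1 / 2 ≤ |x - x₀| → w x = 0 := by
  let χ : ContDiffBump x₀ := ⟨1 / 8, 1 / 2, by norm_num, by norm_num⟩
  have hc : HasCompactSupport fun x => (χ x : ℂ) :=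
    χ.hasCompactSupport.comp_left (g := ((↑) : ℝ → ℂ)) (by simp)
  refine ⟨hc.toSchwartzMap (Complex.ofRealCLM.contDiff.comp χ.contDiff), hc, fun x hx => ?_,
    fun x hx => ?_⟩
  · exact Complex.ofReal_eq_one.2
      (χ.one_of_mem_closedBall (by rwa [Metric.mem_closedBall, Real.dist_eq]))
  · exact Complex.ofReal_eq_zero.2 (χ.zero_of_le_dist (by rwa [Real.dist_eq]))

/-- The Zak transform of `G`, which turns the time-frequency shifts of `G` over `ℤ²` into
multiplication by characters. -/
def zak (G : ℝ → ℂ) (x y : ℝ) : ℂ :=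
  ∑' n : ℤ, G (x + n) * (𝐞 (n * y) : ℂ)

theorem zak_add_one_right (G : ℝ → ℂ) (x y : ℝ) : zak G x (y + 1) = zak G x y := by
  have h (n : ℤ) := fourierChar_int_mul_add_int n 1 y
  simp only [Int.cast_one] at h
  simp only [zak, h]

theorem zak_add_one_left (G : ℝ → ℂ) (x y : ℝ) :
    zak G (x + 1) y = (𝐞 (-y) : ℂ) * zak G x y := by
  rw [zak, zak, ← tsum_mul_left, ← (Equiv.addRight (1 : ℤ)).tsum_eq fun n : ℤ =>
    (𝐞 (-y) : ℂ) * (G (x + n) * (𝐞 (n * y) : ℂ))]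
  refine tsum_congr fun n => ?_
  have hx : x + 1 + n = x + (n + 1 : ℤ) := by push_cast; ring
  have hy : n * y = -y + (n + 1 : ℤ) * y := by push_cast; ring
  rw [Equiv.coe_addRight, mul_left_comm, ← fourierChar_add, hx, hy]

section Expansion

variable {w G : ℝ → ℂ} {x₀ x : ℝ}

theorem hasSum_windowCoeff_mul_fourierChar (hw : Continuous w)
    (hw1 : ∀ x, |x - x₀| ≤ 1 / 8 → w x = 1) (hw0 : ∀ x, 1 / 2 ≤ |x - x₀| → w x = 0)
    (hG : Continuous G) (hsum : Summable fun p : ℤ × ℤ => ‖windowCoeff w G p.1 p.2‖)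
    (hx : |x - x₀| ≤ 1 / 8) (n : ℤ) :
    HasSum (fun m => windowCoeff w G m n * (𝐞 (m * x) : ℂ)) (G (x + n)) := by
  have hrow : Summable fun m => windowCoeff w G m n :=
    (hsum.comp_injective (i := fun m : ℤ => (m, n)) fun _ _ h => (Prod.ext_iff.1 h).1).of_norm
  simpa only [hw1 x hx, one_mul, windowCoeff] using hasSum_fourier_mul_fourierChar
    (f := fun x => w x * G (x + n)) (by fun_prop) (fun y hy => by rw [hw0 y hy, zero_mul]) hrow
    (hx.trans (by norm_num))

theorem summable_and_hasSum_zak (hw : Continuous w)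
    (hw1 : ∀ x, |x - x₀| ≤ 1 / 8 → w x = 1) (hw0 : ∀ x, 1 / 2 ≤ |x - x₀| → w x = 0)
    (hG : Continuous G) (hsum : Summable fun p : ℤ × ℤ => ‖windowCoeff w G p.1 p.2‖)
    (hx : |x - x₀| ≤ 1 / 8) (y : ℝ) :
    (Summable fun n : ℤ => G (x + n)) ∧
      HasSum (fun p : ℤ × ℤ => windowCoeff w G p.1 p.2 * (𝐞 (p.1 * x + p.2 * y) : ℂ))
        (zak G x y) := by
  have hsummable (φ : ℤ × ℤ → ℝ) :
      Summable fun p : ℤ × ℤ => windowCoeff w G p.2 p.1 * (𝐞 (φ p) : ℂ) :=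
    summable_mul_fourierChar ((Equiv.prodComm ℤ ℤ).summable_iff.2 hsum).of_norm φ
  have hcol := hasSum_windowCoeff_mul_fourierChar hw hw1 hw0 hG hsum hx
  refine ⟨(hsummable fun p => p.2 * x).prod.congr fun n => (hcol n).tsum_eq, ?_⟩
  have hrow (n : ℤ) : HasSum (fun m : ℤ => windowCoeff w G m n * (𝐞 (m * x + n * y) : ℂ))
      (G (x + n) * (𝐞 (n * y) : ℂ)) := by
    simpa only [fourierChar_add, mul_assoc] using (hcol n).mul_right (𝐞 (n * y) : ℂ)
  have hzak := (hsummable fun p => p.2 * x + p.1 * y).hasSum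
  rw [(hsummable _).tsum_prod, tsum_congr fun n => (hrow n).tsum_eq] at hzak
  exact (Equiv.prodComm ℤ ℤ).hasSum_iff.1 hzak

end Expansion

end ZakTransform

section ZakZero

theorem exists_continuous_exp_eq {X : Type*} [TopologicalSpace X] [SimplyConnectedSpace X]
    [LocallyPathConnectedSpace X] {F : X → ℂ} (hF : Continuous F) (hF0 : ∀ x, F x ≠ 0) :
    ∃ L : X → ℂ, Continuous L ∧ ∀ x, Complex.exp (L x) = F x := by
  obtain ⟨L, ⟨-, hL⟩, -⟩ := Complex.isCoveringMapOn_exp.existsUnique_continuousMap_lifts ⟨F, hF⟩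
    (Complex.exp_log (hF0 (Classical.arbitrary X))) hF0
  exact ⟨L, L.continuous, congrFun hL⟩

theorem eq_of_forall_exp_eq_one {X : Type*} [TopologicalSpace X] [PreconnectedSpace X]
    {h : X → ℂ} (hh : Continuous h) (hexp : ∀ x, Complex.exp (h x) = 1) (x y : X) : h x = h y := by
  choose k hk using fun x => Complex.exp_eq_one_iff.1 (hexp x)
  have hkh : ((↑) ∘ k : X → ℂ) = fun x => h x / (2 * Real.pi * Complex.I) :=
    funext fun x => by
      rw [hk x, mul_div_cancel_right₀ _ Complex.two_pi_I_ne_zero, Function.comp_apply]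
  have hkcont : Continuous k :=
    Complex.isClosedEmbedding_intCast.continuous_iff.2 (hkh ▸ hh.div_const _)
  rw [hk x, hk y, PreconnectedSpace.constant inferInstance hkcont]

-- Along the boundary of the unit square the argument of `F` would change by `2π`.
theorem exists_eq_zero_of_quasiperiodic {F : ℝ → ℝ → ℂ} (hF : Continuous (Function.uncurry F))
    (hleft : ∀ x y, F (x + 1) y = (𝐞 (-y) : ℂ) * F x y) (hright : ∀ x y, F x (y + 1) = F x y) :
    ∃ x y, F x y = 0 := by
  by_contra! hF0
  obtain ⟨L, hL, hexp⟩ := exists_continuous_exp_eq hF fun z => hF0 z.1 z.2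
  have hvertical := eq_of_forall_exp_eq_one (h := fun z : ℝ × ℝ => L (z.1, z.2 + 1) - L z)
    (by fun_prop) (fun z => by
      rw [Complex.exp_sub, hexp, hexp, Function.uncurry_apply_pair, hright]
      exact div_self (hF0 _ _)) (1, 0) (0, 0)
  have hhorizontal := eq_of_forall_exp_eq_one
    (h := fun z : ℝ × ℝ => L (z.1 + 1, z.2) - L z + 2 * Real.pi * z.2 * Complex.I)
    (by fun_prop) (fun z => by
      rw [Complex.exp_add, Complex.exp_sub, hexp, hexp, Function.uncurry_apply_pair, hleft,
        Function.uncurry_def, mul_div_cancel_right₀ _ (hF0 _ _), Real.fourierChar_apply,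
        ← Complex.exp_add]
      simp) (0, 1) (0, 0)
  simp only [zero_add, Complex.ofReal_one, Complex.ofReal_zero, mul_one, mul_zero, zero_mul,
    add_zero] at hvertical hhorizontal
  exact Complex.two_pi_I_ne_zero (by linear_combination hhorizontal - hvertical)

theorem continuous_uncurry_of_hasSum_fourierChar {F : ℝ → ℝ → ℂ} {δ : ℝ} (hδ : 0 < δ)
    (hF : ∀ x₀, ∃ c : ℤ × ℤ → ℂ, Summable c ∧ ∀ x y, |x - x₀| ≤ δ →
      HasSum (fun p => c p * (𝐞 (p.1 * x + p.2 * y) : ℂ)) (F x y)) :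
    Continuous (Function.uncurry F) := by
  rw [continuous_iff_continuousAt]
  rintro ⟨x₀, y₀⟩
  obtain ⟨c, hc, hsum⟩ := hF x₀
  have hseries : Continuous fun z : ℝ × ℝ =>
      ∑' p : ℤ × ℤ, c p * (𝐞 (p.1 * z.1 + p.2 * z.2) : ℂ) :=
    continuous_tsum (fun p => by fun_prop) hc.norm fun p z => by simp
  refine hseries.continuousAt.congr ?_
  filter_upwards [continuousAt_fst.preimage_mem_nhds (Metric.closedBall_mem_nhds x₀ hδ)] with z hz
  exact (hsum z.1 z.2 hz).tsum_eq

theorem norm_fourierChar_add_sub_le (s s₀ t t₀ : ℝ) :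
    ‖(𝐞 (s + t) : ℂ) - 𝐞 (s₀ + t₀)‖
      ≤ 2 * Real.pi * (min 1 |s - s₀| + min 1 |t - t₀|) := by
  have hs : (𝐞 s : ℂ) = 𝐞 (s - s₀) * 𝐞 s₀ := by rw [← fourierChar_add, sub_add_cancel]
  have ht : (𝐞 t : ℂ) = 𝐞 (t - t₀) * 𝐞 t₀ := by rw [← fourierChar_add, sub_add_cancel]
  calc ‖(𝐞 (s + t) : ℂ) - 𝐞 (s₀ + t₀)‖
      = ‖(𝐞 t : ℂ) * 𝐞 s₀ * (𝐞 (s - s₀) - 1) + (𝐞 s₀ : ℂ) * 𝐞 t₀ * (𝐞 (t - t₀) - 1)‖ := by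
        rw [fourierChar_add, fourierChar_add, hs, ht]; ring_nf
    _ ≤ 2 * Real.pi * min 1 |s - s₀| + 2 * Real.pi * min 1 |t - t₀| := by
        refine (norm_add_le _ _).trans ?_
        simpa only [norm_mul, norm_fourierChar_coe, one_mul] using
          add_le_add (norm_fourierChar_sub_one_le (s - s₀)) (norm_fourierChar_sub_one_le (t - t₀))
    _ = _ := (mul_add _ _ _).symm

theorem norm_le_tsum_of_hasSum_fourierChar_zero {c : ℤ × ℤ → ℂ} (hc : Summable c)
    {x₀ y₀ x y a b : ℝ} {z : ℂ}
    (h₀ : HasSum (fun p => c p * (𝐞 (p.1 * x₀ + p.2 * y₀) : ℂ)) 0)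
    (hz : HasSum (fun p => c p * (𝐞 (p.1 * x + p.2 * y) : ℂ)) z)
    (hx : |x - x₀| ≤ a) (hy : |y - y₀| ≤ b) :
    ‖z‖ ≤ 2 * Real.pi * (∑' p, ‖c p‖ * min 1 (|(p.1 : ℝ)| * a)
      + ∑' p, ‖c p‖ * min 1 (|(p.2 : ℝ)| * b)) := by
  have ha : 0 ≤ a := (abs_nonneg _).trans hx
  have hb : 0 ≤ b := (abs_nonneg _).trans hy
  have hsummable {φ : ℤ × ℤ → ℝ} (hφ : ∀ p, 0 ≤ φ p) : Summable fun p => ‖c p‖ * min 1 (φ p) :=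
    .of_nonneg_of_le (fun p => mul_nonneg (norm_nonneg _) (le_min zero_le_one (hφ p)))
      (fun p => mul_le_of_le_one_right (norm_nonneg _) (min_le_left _ _)) hc.norm
  have hx' := hsummable (φ := fun p => |(p.1 : ℝ)| * a) fun p => by positivity
  have hy' := hsummable (φ := fun p => |(p.2 : ℝ)| * b) fun p => by positivity
  rw [← hx'.tsum_add hy', ← tsum_mul_left, ← sub_zero z, ← (hz.sub h₀).tsum_eq]
  refine tsum_of_norm_bounded ((hx'.add hy').mul_left _).hasSum fun p => ?_
  rw [← mul_sub, norm_mul, ← mul_add, mul_left_comm]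
  refine mul_le_mul_of_nonneg_left ((norm_fourierChar_add_sub_le _ _ _ _).trans ?_) (norm_nonneg _)
  rw [← mul_sub, ← mul_sub, abs_mul, abs_mul]
  gcongr

end ZakZero

section ZakModulus

theorem exists_hasSum_zak {r t : ℝ} (hr : 1 < r) (h1 : 1 < t * (1 - 1 / r))
    {g : Lp ℂ 2 (volume : Measure ℝ)} (hgr : momentL2 r g ≠ ⊤) (hgt : momentL2 t (𝓕 g) ≠ ⊤) :
    ∃ G : ℝ → ℂ, g =ᵐ[volume] G ∧ ∀ x₀, ∃ c : ℤ × ℤ → ℂ,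
      (Summable fun p => ‖c p‖ ^ 2 * latticeWeight t r p) ∧ ∀ x y, |x - x₀| ≤ 1 / 8 →
        (Summable fun n : ℤ => G (x + n)) ∧
          HasSum (fun p => c p * (𝐞 (p.1 * x + p.2 * y) : ℂ)) (zak G x y) := by
  have hr0 : 0 < 1 / r := by positivity
  have ht : 1 < t := by
    have hr1 : 1 / r < 1 := (div_lt_one (by positivity)).2 hr
    nlinarith
  obtain ⟨G, hG, hgG⟩ := exists_continuous_ae_eq_of_integrable_fourier
    (integrable_of_lintegral_one_add_enorm_rpow_mul_ne_top ht (Lp.aestronglyMeasurable _)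
      (lintegral_one_add_enorm_rpow_mul_ne_top (by linarith) hgt))
  refine ⟨G, hgG, fun x₀ => ?_⟩
  obtain ⟨w, hw, hw1, hw0⟩ := exists_schwartzMap_eq_one_of_abs_le x₀
  have hc := summable_norm_windowCoeff_sq_mul_latticeWeight (by linarith) (by linarith) hw hgr hgt
  simp only [windowCoeff_congr_ae w hgG] at hc
  exact ⟨_, hc, fun x y hx => summable_and_hasSum_zak w.continuous hw1 hw0 hG
    (summable_norm_of_latticeWeight hr h1 hc) hx y⟩

theorem exists_isLittleO_norm_zak_le {r t : ℝ} (hr : 1 < r) (ht : 1 < t)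
    (hrt : 1 < t * (1 - 1 / r)) (hrt3 : t * (1 - 1 / r) < 3)
    (htr : 1 < r * (1 - 1 / t)) (htr3 : r * (1 - 1 / t) < 3)
    {G : ℝ → ℂ} {c : ℤ × ℤ → ℂ} (hc : Summable fun p => ‖c p‖ ^ 2 * latticeWeight t r p)
    {x₀ y₀ δ : ℝ} (hδ : 0 < δ) (hG : ∀ x y, |x - x₀| ≤ δ →
      HasSum (fun p => c p * (𝐞 (p.1 * x + p.2 * y) : ℂ)) (zak G x y)) (h₀ : zak G x₀ y₀ = 0) :
    ∃ σ : ℝ → ℝ, σ =o[𝓝[>] 0] (fun ε : ℝ => ε ^ (1 - 1 / r - 1 / t)) ∧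
      ∀ᶠ ε in 𝓝[>] 0, ∀ x y, |x - x₀| ≤ ε ^ (2 / t) → |y - y₀| ≤ ε ^ (2 / r) →
        ‖zak G x y‖ ≤ σ ε := by
  have hx := isLittleO_tsum_norm_mul_min_one hr (by linarith) hrt hrt3 hc
  have hc' : Summable fun p : ℤ × ℤ => ‖c p.swap‖ ^ 2 * latticeWeight r t p := by
    simpa only [Function.comp_def, Equiv.prodComm_apply, latticeWeight_swap] using
      (Equiv.prodComm ℤ ℤ).summable_iff.2 hc
  have hy := isLittleO_tsum_norm_mul_min_one ht (by linarith) htr htr3 hc'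
  have hswap (ε : ℝ) : ∑' p : ℤ × ℤ, ‖c p.swap‖ * min 1 (|(p.1 : ℝ)| * ε ^ (2 / r))
      = ∑' p : ℤ × ℤ, ‖c p‖ * min 1 (|(p.2 : ℝ)| * ε ^ (2 / r)) :=
    (Equiv.prodComm ℤ ℤ).tsum_eq fun p => ‖c p‖ * min 1 (|(p.2 : ℝ)| * ε ^ (2 / r))
  simp only [hswap, sub_right_comm (1 : ℝ) (1 / t)] at hy
  refine ⟨_, (hx.add hy).const_mul_left (2 * Real.pi), ?_⟩
  have hsmall : ∀ᶠ ε : ℝ in 𝓝[>] 0, ε ^ (2 / t) < δ :=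
    (tendsto_rpow_nhdsGT_zero (by positivity)).eventually_lt_const hδ
  filter_upwards [hsmall] with ε hε x y hxε hyε
  exact norm_le_tsum_of_hasSum_fourierChar_zero (summable_norm_of_latticeWeight hr hrt hc).of_norm
    (h₀ ▸ hG x₀ y₀ (by simpa using hδ.le)) (hG x y (hxε.trans hε.le)) hxε hyε

end ZakModulus

section GaborSeries

theorem ae_eq_of_hasSum_of_ae_hasSum {ι α E : Type*} [Countable ι] [MeasurableSpace α]
    {μ : Measure α} [NormedAddCommGroup E] {p : ℝ≥0∞} [Fact (1 ≤ p)] {f : ι → Lp E p μ}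
    {h : Lp E p μ} (hf : HasSum f h) {F : α → E}
    (hF : ∀ᵐ x ∂μ, HasSum (fun i => f i x) (F x)) : h =ᵐ[μ] F := by
  obtain ⟨S, hS, hlim⟩ := (tendstoInMeasure_of_tendsto_Lp hf).exists_seq_tendsto_ae'
  have hsum := ae_all_iff.2 fun n => Lp.coeFn_finsetSum (S n) f
  filter_upwards [hlim, hsum, hF] with x hx hsumx hFx
  refine tendsto_nhds_unique hx ((hFx.comp hS).congr fun n => ?_)
  rw [hsumx n, Finset.sum_apply, Function.comp_apply]

theorem enorm_sq_eq_lintegral {α E : Type*} [MeasurableSpace α] {μ : Measure α}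
    [NormedAddCommGroup E] (f : Lp E 2 μ) : ‖f‖ₑ ^ 2 = ∫⁻ x, ‖f x‖ₑ ^ 2 ∂μ := by
  rw [Lp.enorm_def]
  simpa [ENNReal.rpow_two] using
    eLpNorm_nnreal_pow_eq_lintegral (p := 2) (f := f) (μ := μ) two_ne_zero

theorem lintegral_eq_setLIntegral_tsum_add_int (a : ℝ) {f : ℝ → ℝ≥0∞} (hf : AEMeasurable f) :
    ∫⁻ x, f x = ∫⁻ x in Set.Ioc a (a + 1), ∑' k : ℤ, f (x + k) := by
  have hshift (k : ℤ) := measurePreserving_add_right volume (k : ℝ)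
  have hmeas (k : ℤ) : AEMeasurable (fun x => f (x + k)) (volume.restrict (Set.Ioc a (a + 1))) :=
    (hf.comp_quasiMeasurePreserving (hshift k).quasiMeasurePreserving).restrict
  rw [lintegral_tsum hmeas, ← tsum_setLIntegral_Ioc_add_int a]
  refine tsum_congr fun k => ?_
  rw [← (hshift k).setLIntegral_comp_preimage_emb (measurableEmbedding_addRight _),
    Set.preimage_add_const_Ioc, add_sub_cancel_right, add_right_comm, add_sub_cancel_right]

theorem gaborFun_eq (g : Lp ℂ 2 (volume : Measure ℝ)) (m n : ℤ) (x : ℝ) :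
    gaborFun g m n x = (𝐞 (m * x) : ℂ) * g (x - n) := by
  rw [gaborFun, Real.fourierChar_apply]
  congr 2
  push_cast
  ring

theorem norm_gaborSystem (g : Lp ℂ 2 (volume : Measure ℝ)) (p : ℤ × ℤ) :
    ‖gaborSystem g p‖ = ‖g‖ := by
  rw [gaborSystem, Lp.norm_toLp, Lp.norm_def,
    eLpNorm_congr_norm_ae (g := fun x => g (x - p.2)) (.of_forall fun x => by simp [gaborFun_eq])]
  exact congrArg _ (eLpNorm_comp_measurePreserving (Lp.aestronglyMeasurable g)
    (measurePreserving_sub_right volume (p.2 : ℝ)))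

theorem summable_smul_gaborSystem {A B : ℤ → ℂ} (hA : Summable A) (hB : Summable B)
    (g : Lp ℂ 2 (volume : Measure ℝ)) :
    Summable fun p : ℤ × ℤ => (A p.1 * B p.2) • gaborSystem g p := by
  refine .of_norm ?_
  simp only [norm_smul, norm_mul, norm_gaborSystem]
  exact (hA.norm.mul_of_nonneg hB.norm (fun _ => norm_nonneg _) fun _ => norm_nonneg _).mul_right _

variable {g h : Lp ℂ 2 (volume : Measure ℝ)} {G : ℝ → ℂ} {A B : ℤ → ℂ}

theorem ae_eq_of_hasSum_smul_gaborSystem (hgG : g =ᵐ[volume] G)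
    (hG : ∀ x, Summable fun n : ℤ => G (x + n)) (hA : Summable A) (hB : Summable B)
    (hh : HasSum (fun p : ℤ × ℤ => (A p.1 * B p.2) • gaborSystem g p) h) :
    h =ᵐ[volume] fun x => (∑' m : ℤ, A m * (𝐞 (m * x) : ℂ)) * ∑' n : ℤ, B n * G (x - n) := by
  refine ae_eq_of_hasSum_of_ae_hasSum hh ?_
  have hterm : ∀ᵐ x, ∀ p : ℤ × ℤ, ((A p.1 * B p.2) • gaborSystem g p : Lp ℂ 2 volume) x
      = A p.1 * (𝐞 (p.1 * x) : ℂ) * (B p.2 * G (x - p.2)) := by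
    refine ae_all_iff.2 fun p => ?_
    have hshift : (fun x => g (x - p.2)) =ᵐ[volume] fun x => G (x - p.2) :=
      (measurePreserving_sub_right volume (p.2 : ℝ)).quasiMeasurePreserving.ae_eq_comp hgG
    filter_upwards [Lp.coeFn_smul (A p.1 * B p.2) (gaborSystem g p),
      (memLp_gaborFun g p.1 p.2).coeFn_toLp, hshift] with x hsmul hgabor hx
    rw [hsmul, Pi.smul_apply, gaborSystem, hgabor, gaborFun_eq, hx, smul_eq_mul]
    ring
  filter_upwards [hterm] with x hx
  have hB' : Summable fun n : ℤ => ‖B n * G (x - n)‖ := by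
    refine .of_nonneg_of_le (fun _ => norm_nonneg _) (fun n => ?_)
      (hB.norm.mul_right (∑' k : ℤ, ‖G (x + k)‖))
    rw [norm_mul]
    gcongr
    simpa [sub_eq_add_neg] using (hG x).norm.le_tsum (-n) fun _ _ => norm_nonneg _
  have hA' := summable_mul_fourierChar hA fun m : ℤ => m * x
  simp only [hx]
  exact hasSum_mul_of_summable_norm (u := fun m : ℤ => A m * (𝐞 (m * x) : ℂ))
    (v := fun n : ℤ => B n * G (x - n)) hA'.norm hB'

theorem tsum_enorm_sq_tsum_mul_eq (hB : Summable B) {x : ℝ} (hG : Summable fun n : ℤ => G (x + n))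
    (b : ℝ) :
    ∑' k : ℤ, ‖∑' n : ℤ, B n * G (x + k - n)‖ₑ ^ 2 = ∫⁻ y in Set.Ioc b (b + 1),
      ‖(∑' n : ℤ, B n * (𝐞 (n * y) : ℂ)) * zak G x y‖ₑ ^ 2 := by
  have hconv (y : ℝ) : ∑' k : ℤ, (∑' n : ℤ, B n * G (x + (k - n : ℤ))) * (𝐞 (k * y) : ℂ)
      = (∑' n : ℤ, B n * (𝐞 (n * y) : ℂ)) * zak G x y :=
    (hasSum_convolution_mul_fourierChar hB hG y).tsum_eq
  have h := tsum_enorm_sq_of_summable b (hasSum_tsum_mul_sub hB.norm hG.norm).summable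
  simp only [hconv] at h
  simpa only [Int.cast_sub, ← add_sub_assoc] using h

theorem enorm_sq_eq_of_hasSum_smul_gaborSystem (hgG : g =ᵐ[volume] G)
    (hG : ∀ x, Summable fun n : ℤ => G (x + n)) (hA : Summable A) (hB : Summable B)
    (hh : HasSum (fun p : ℤ × ℤ => (A p.1 * B p.2) • gaborSystem g p) h) (a b : ℝ) :
    ‖h‖ₑ ^ 2 = ∫⁻ x in Set.Ioc a (a + 1), ‖∑' m : ℤ, A m * (𝐞 (m * x) : ℂ)‖ₑ ^ 2 *
      ∫⁻ y in Set.Ioc b (b + 1), ‖(∑' n : ℤ, B n * (𝐞 (n * y) : ℂ)) * zak G x y‖ₑ ^ 2 := by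
  have hae := ae_eq_of_hasSum_smul_gaborSystem hgG hG hA hB hh
  have hnorm := hae.fun_comp (‖·‖ₑ ^ 2)
  have hmeas := ((Lp.aestronglyMeasurable h).enorm.pow_const 2).congr hnorm
  rw [enorm_sq_eq_lintegral]
  refine (lintegral_congr_ae hnorm).trans
    ((lintegral_eq_setLIntegral_tsum_add_int a hmeas).trans (lintegral_congr fun x => ?_))
  simp only [Function.comp_apply, enorm_mul, mul_pow, fourierChar_int_mul_add_int,
    ENNReal.tsum_mul_left, tsum_enorm_sq_tsum_mul_eq hB (hG x) b]

end GaborSeries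

section LocalizedSeries

theorem norm_fourier_comp_sub_div (f : ℝ → ℂ) {a : ℝ} (ha : 0 < a) (x₀ w : ℝ) :
    ‖𝓕 (fun x => f ((x - x₀) / a)) w‖ = a * ‖𝓕 f (a * w)‖ := by
  have htranslate := integral_sub_right_eq_self (μ := (volume : Measure ℝ))
    (fun v => (𝐞 (-(w * (v + x₀))) : ℂ) * f (v / a)) x₀
  simp only [sub_add_cancel] at htranslate
  have hdilate := Measure.integral_comp_div (fun v => (𝐞 (-(w * (v * a + x₀))) : ℂ) * f v) a
  simp only [div_mul_cancel₀ _ ha.ne'] at hdilate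
  have hphase (v : ℝ) : (𝐞 (-(w * (v * a + x₀))) : ℂ) * f v
      = 𝐞 (-(w * x₀)) * (𝐞 (-(a * w * v)) * f v) := by
    rw [← mul_assoc, ← fourierChar_add]
    ring_nf
  rw [fourier_eq_integral_fourierChar_mul, htranslate, hdilate, norm_smul, Real.norm_eq_abs,
    abs_abs, abs_of_pos ha]
  simp only [hphase, integral_const_mul, norm_mul, norm_fourierChar_coe, one_mul,
    fourier_eq_integral_fourierChar_mul]

theorem summable_fourier_intCast {f : ℝ → ℂ} (hf : ContDiff ℝ ∞ f) (hc : HasCompactSupport f) :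
    Summable fun n : ℤ => 𝓕 f n := by
  set F : 𝓢(ℝ, ℂ) := 𝓕 (hc.toSchwartzMap hf) with hF
  have hFf : (F : ℝ → ℂ) = 𝓕 f := by
    rw [hF, SchwartzMap.fourier_coe]
    rfl
  rw [← hFf]
  exact summable_of_isBigO (Real.summable_abs_int_rpow one_lt_two)
    ((F.isBigO_cocompact_rpow (-2)).comp_tendsto Int.tendsto_coe_cofinite)

theorem le_sum_Icc_norm_rpow {E : Type*} [NormedAddCommGroup E] {q : ℝ} (hq : 0 ≤ q)
    {δ κ a : ℝ} (hδ : 0 ≤ δ) (hκ : 0 ≤ κ) (ha : 0 < a) {A : ℤ → E}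
    (hA : ∀ m : ℤ, |a * m| ≤ δ → a * κ ≤ ‖A m‖) :
    δ * κ ^ q * a ^ (q - 1) ≤ ∑ m ∈ Finset.Icc 0 ⌊δ / a⌋, ‖A m‖ ^ q := by
  have hfloor : 0 ≤ ⌊δ / a⌋ := Int.floor_nonneg.2 (by positivity)
  have hcard : δ / a ≤ (Finset.Icc 0 ⌊δ / a⌋).card := by
    rw [Int.card_Icc, ← Int.cast_natCast, Int.toNat_of_nonneg (by lia)]
    simpa using (Int.lt_floor_add_one (δ / a)).le
  have hterm (m : ℤ) (hm : m ∈ Finset.Icc 0 ⌊δ / a⌋) : (a * κ) ^ q ≤ ‖A m‖ ^ q := by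
    obtain ⟨hm0, hm1⟩ := Finset.mem_Icc.1 hm
    refine Real.rpow_le_rpow (by positivity) (hA m ?_) hq
    rw [abs_of_nonneg (by positivity), ← le_div_iff₀' ha]
    exact Int.le_floor.1 hm1
  calc δ * κ ^ q * a ^ (q - 1) = δ / a * (a * κ) ^ q := by
        rw [Real.mul_rpow ha.le hκ, Real.rpow_sub_one ha.ne']
        ring
    _ ≤ (Finset.Icc 0 ⌊δ / a⌋).card * (a * κ) ^ q := by gcongr
    _ ≤ ∑ m ∈ Finset.Icc 0 ⌊δ / a⌋, ‖A m‖ ^ q := by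
        rw [← nsmul_eq_mul]
        exact Finset.card_nsmul_le_sum _ _ _ hterm

theorem exists_bump_le_norm_fourier : ∃ φ : ℝ → ℂ, ContDiff ℝ ∞ φ ∧ (∀ x, ‖φ x‖ ≤ 1) ∧
    (∀ x, 1 ≤ |x| → φ x = 0) ∧
      ∃ δ κ : ℝ, 0 < δ ∧ 0 < κ ∧ ∀ ξ, |ξ| ≤ δ → κ ≤ ‖𝓕 φ ξ‖ := by
  let b : ContDiffBump (0 : ℝ) := ⟨1 / 2, 1, by norm_num, by norm_num⟩
  set φ : ℝ → ℂ := fun x => b x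
  have hφ : ContDiff ℝ ∞ φ := Complex.ofRealCLM.contDiff.comp b.contDiff
  have hφ0 (x : ℝ) (hx : 1 ≤ |x|) : φ x = 0 :=
    Complex.ofReal_eq_zero.2 (b.zero_of_le_dist (by simpa [Real.dist_eq] using hx))
  have hint : 𝓕 φ 0 ≠ 0 := by
    have hzero : 𝓕 φ 0 = ((∫ x, b x : ℝ) : ℂ) := by
      simp [φ, fourier_eq_integral_fourierChar_mul, integral_complex_ofReal]
    rw [hzero]
    exact_mod_cast (b.integral_pos (μ := volume)).ne'
  have hc : HasCompactSupport φ := .intro (isCompact_closedBall 0 1) fun x hx =>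
    hφ0 x (by simpa [Real.dist_eq] using hx : 1 < |x|).le
  have hcont : Continuous (𝓕 φ) := by
    have h := (𝓕 (hc.toSchwartzMap hφ)).continuous
    rwa [SchwartzMap.fourier_coe] at h
  have hev := (hcont.norm.tendsto 0).eventually
    (lt_mem_nhds (half_lt_self (norm_pos_iff.2 hint)))
  obtain ⟨δ, hδ, hball⟩ := Metric.nhds_basis_closedBall.eventually_iff.1 hev
  refine ⟨φ, hφ, fun x => ?_, hφ0, δ, ‖𝓕 φ 0‖ / 2, hδ, by positivity,
    fun ξ hξ => (hball (by simpa [Real.dist_eq] using hξ)).le⟩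
  rw [Complex.norm_real, Real.norm_of_nonneg b.nonneg]
  exact b.le_one

theorem exists_localized_fourierSeries {q : ℝ} (hq : 0 ≤ q) :
    ∃ c : ℝ, 0 < c ∧ ∀ a : ℝ, 0 < a → a ≤ 1 / 2 → ∀ x₀ : ℝ, ∃ A : ℤ → ℂ, Summable A ∧
      (∀ x, |x - x₀| ≤ 1 / 2 → ‖∑' m : ℤ, A m * (𝐞 (m * x) : ℂ)‖ ≤ 1) ∧
      (∀ x, |x - x₀| ≤ 1 / 2 → a ≤ |x - x₀| → ∑' m : ℤ, A m * (𝐞 (m * x) : ℂ) = 0) ∧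
      ∃ s : Finset ℤ, c * a ^ (q - 1) ≤ ∑ m ∈ s, ‖A m‖ ^ q := by
  obtain ⟨φ, hφ, hφ1, hφ0, δ, κ, hδ, hκ, hlow⟩ := exists_bump_le_norm_fourier
  refine ⟨δ * κ ^ q, by positivity, fun a ha ha2 x₀ => ?_⟩
  set f : ℝ → ℂ := fun x => φ ((x - x₀) / a)
  have hf0 (x : ℝ) (hx : a ≤ |x - x₀|) : f x = 0 := by
    refine hφ0 _ ?_
    rwa [abs_div, abs_of_pos ha, one_le_div ha]
  have hfc : HasCompactSupport f := .intro (isCompact_closedBall x₀ a) fun x hx =>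
    hf0 x (by simpa [Real.dist_eq] using hx : a < |x - x₀|).le
  have hf : ContDiff ℝ ∞ f := hφ.comp (by fun_prop)
  have hsum := summable_fourier_intCast hf hfc
  have hseries (x : ℝ) (hx : |x - x₀| ≤ 1 / 2) :=
    (hasSum_fourier_mul_fourierChar hf.continuous (fun y hy => hf0 y (ha2.trans hy)) hsum
      hx).tsum_eq
  refine ⟨fun n => 𝓕 f n, hsum, fun x hx => (hseries x hx).symm ▸ hφ1 _,
    fun x hx hxa => (hseries x hx).trans (hf0 x hxa), _,
    le_sum_Icc_norm_rpow hq hδ.le hκ.le ha fun m hm => ?_⟩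
  rw [norm_fourier_comp_sub_div φ ha]
  exact mul_le_mul_of_nonneg_left (hlow _ hm) ha.le

end LocalizedSeries

section LowerBound

theorem setLIntegral_le_of_localized {s : Set ℝ} (hs : MeasurableSet s) {f : ℝ → ℝ≥0∞} {K : ℝ≥0∞}
    {x₀ a : ℝ} (hle : ∀ x ∈ s, |x - x₀| ≤ a → f x ≤ K) (hzero : ∀ x ∈ s, a < |x - x₀| → f x = 0) :
    ∫⁻ x in s, f x ≤ K * ENNReal.ofReal (2 * a) := by
  calc ∫⁻ x in s, f x ≤ ∫⁻ x in s, (Metric.closedBall x₀ a).indicator (fun _ => K) x := by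
        refine setLIntegral_mono' hs fun x hx => ?_
        by_cases hxa : |x - x₀| ≤ a
        · rw [Set.indicator_of_mem (by simpa [Real.dist_eq] using hxa)]
          exact hle x hx hxa
        · exact (hzero x hx (not_le.1 hxa)).trans_le zero_le
    _ ≤ ∫⁻ x, (Metric.closedBall x₀ a).indicator (fun _ => K) x := setLIntegral_le_lintegral _ _
    _ = K * ENNReal.ofReal (2 * a) := by
        rw [lintegral_indicator_const Metric.isClosed_closedBall.measurableSet,
          Real.volume_closedBall]

theorem lintegral_enorm_sq_mul_lintegral_le_of_localized {s s' : Set ℝ} (hs : MeasurableSet s)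
    (hs' : MeasurableSet s') {u v : ℝ → ℂ} {F : ℝ → ℝ → ℂ} {x₀ y₀ a b σ : ℝ}
    (hu : ∀ x ∈ s, ‖u x‖ ≤ 1) (hu₀ : ∀ x ∈ s, a < |x - x₀| → u x = 0)
    (hv : ∀ y ∈ s', ‖v y‖ ≤ 1) (hv₀ : ∀ y ∈ s', b < |y - y₀| → v y = 0)
    (hF : ∀ x y, |x - x₀| ≤ a → |y - y₀| ≤ b → ‖F x y‖ ≤ σ) :
    ∫⁻ x in s, ‖u x‖ₑ ^ 2 * ∫⁻ y in s', ‖v y * F x y‖ₑ ^ 2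
      ≤ ENNReal.ofReal σ ^ 2 * ENNReal.ofReal (2 * b) * ENNReal.ofReal (2 * a) := by
  have hinner (x : ℝ) (hx : |x - x₀| ≤ a) :
      ∫⁻ y in s', ‖v y * F x y‖ₑ ^ 2 ≤ ENNReal.ofReal σ ^ 2 * ENNReal.ofReal (2 * b) := by
    refine setLIntegral_le_of_localized (x₀ := y₀) hs' (fun y hy hyb => ?_)
      fun y hy hyb => by simp [hv₀ y hy hyb]
    rw [← ofReal_norm]
    gcongr
    rw [norm_mul]
    exact (mul_le_of_le_one_left (norm_nonneg _) (hv y hy)).trans (hF x y hx hyb)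
  refine setLIntegral_le_of_localized (x₀ := x₀) hs (fun x hx hxa => ?_) fun x hx hxa => by
    simp [hu₀ x hx hxa]
  have hu' : ‖u x‖ₑ ≤ 1 := by
    rw [← ofReal_norm]
    exact ENNReal.ofReal_le_one.2 (hu x hx)
  exact (mul_le_of_le_one_left zero_le (pow_le_one₀ zero_le hu')).trans (hinner x hxa)

theorem norm_le_of_hasSum_smul_gaborSystem_of_localized {g h : Lp ℂ 2 (volume : Measure ℝ)}
    {G : ℝ → ℂ} (hgG : g =ᵐ[volume] G) (hG : ∀ x, Summable fun n : ℤ => G (x + n))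
    {A B : ℤ → ℂ} (hA : Summable A) (hB : Summable B)
    (hh : HasSum (fun p : ℤ × ℤ => (A p.1 * B p.2) • gaborSystem g p) h)
    {x₀ y₀ a b σ : ℝ} (ha : 0 ≤ a) (hb : 0 ≤ b)
    (hA₁ : ∀ x, |x - x₀| ≤ 1 / 2 → ‖∑' m : ℤ, A m * (𝐞 (m * x) : ℂ)‖ ≤ 1)
    (hA₀ : ∀ x, |x - x₀| ≤ 1 / 2 → a < |x - x₀| → ∑' m : ℤ, A m * (𝐞 (m * x) : ℂ) = 0)
    (hB₁ : ∀ y, |y - y₀| ≤ 1 / 2 → ‖∑' n : ℤ, B n * (𝐞 (n * y) : ℂ)‖ ≤ 1)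
    (hB₀ : ∀ y, |y - y₀| ≤ 1 / 2 → b < |y - y₀| → ∑' n : ℤ, B n * (𝐞 (n * y) : ℂ) = 0)
    (hzak : ∀ x y, |x - x₀| ≤ a → |y - y₀| ≤ b → ‖zak G x y‖ ≤ σ) :
    ‖h‖ ≤ 2 * (√(a * b) * σ) := by
  have hσ : 0 ≤ σ := (norm_nonneg _).trans (hzak x₀ y₀ (by simpa) (by simpa))
  have hcell {z w : ℝ} (hw : w ∈ Set.Ioc (z - 1 / 2) (z - 1 / 2 + 1)) : |w - z| ≤ 1 / 2 :=
    abs_le.2 ⟨by linarith [hw.1], by linarith [hw.2]⟩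
  have hle := lintegral_enorm_sq_mul_lintegral_le_of_localized measurableSet_Ioc
    measurableSet_Ioc (fun x hx => hA₁ x (hcell hx)) (fun x hx => hA₀ x (hcell hx))
    (fun y hy => hB₁ y (hcell hy)) (fun y hy => hB₀ y (hcell hy)) hzak
  rw [← enorm_sq_eq_of_hasSum_smul_gaborSystem hgG hG hA hB hh, ← ofReal_norm,
    ← ENNReal.ofReal_pow (norm_nonneg _), ← ENNReal.ofReal_pow hσ,
    ← ENNReal.ofReal_mul (by positivity), ← ENNReal.ofReal_mul (by positivity),
    ENNReal.ofReal_le_ofReal_iff (by positivity)] at hle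
  refine le_of_sq_le_sq ?_ (by positivity)
  calc ‖h‖ ^ 2 ≤ σ ^ 2 * (2 * b) * (2 * a) := hle
    _ = (2 * (√(a * b) * σ)) ^ 2 := by
        rw [mul_pow, mul_pow, Real.sq_sqrt (by positivity)]
        ring

theorem IsExactCqSystem.exists_mul_rpow_le_of_norm_zak_le {q : ℝ} (hq : 0 < q)
    {g : Lp ℂ 2 (volume : Measure ℝ)} (hg : IsExactCqSystem q (gaborSystem g)) {G : ℝ → ℂ}
    (hgG : g =ᵐ[volume] G) (hG : ∀ x, Summable fun n : ℤ => G (x + n)) :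
    ∃ c : ℝ, 0 < c ∧ ∀ x₀ y₀ a b σ : ℝ, 0 < a → a ≤ 1 / 2 → 0 < b → b ≤ 1 / 2 →
      (∀ x y, |x - x₀| ≤ a → |y - y₀| ≤ b → ‖zak G x y‖ ≤ σ) →
        c * (a * b) ^ (1 - 1 / q) ≤ √(a * b) * σ := by
  obtain ⟨C, hC, hbound⟩ := hg.2.exists_sum_norm_rpow_le_of_hasSum hq hg.1.2
  obtain ⟨c, hc, hloc⟩ := exists_localized_fourierSeries hq.le
  refine ⟨(c * c) ^ (1 / q) / (2 * C), by positivity, fun x₀ y₀ a b σ ha ha2 hb hb2 hzak => ?_⟩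
  obtain ⟨A, hA, hA1, hA0, s, hs⟩ := hloc a ha ha2 x₀
  obtain ⟨B, hB, hB1, hB0, s', hs'⟩ := hloc b hb hb2 y₀
  obtain ⟨h, hh⟩ := summable_smul_gaborSystem hA hB g
  have hnorm := norm_le_of_hasSum_smul_gaborSystem_of_localized hgG hG hA hB hh ha.le hb.le
    hA1 (fun x hx hxa => hA0 x hx hxa.le) hB1 (fun y hy hyb => hB0 y hy hyb.le) hzak
  have hcoeff : c * c * (a * b) ^ (q - 1) ≤ (C * ‖h‖) ^ q :=
    calc c * c * (a * b) ^ (q - 1) = c * a ^ (q - 1) * (c * b ^ (q - 1)) := by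
          rw [Real.mul_rpow ha.le hb.le]
          ring
      _ ≤ (∑ m ∈ s, ‖A m‖ ^ q) * ∑ n ∈ s', ‖B n‖ ^ q := by gcongr
      _ = ∑ p ∈ s ×ˢ s', ‖A p.1 * B p.2‖ ^ q := by
          simp only [norm_mul, Real.mul_rpow (norm_nonneg _) (norm_nonneg _),
            Finset.sum_mul_sum, Finset.sum_product]
      _ ≤ (C * ‖h‖) ^ q := hbound _ h hh _
  have hroot : (c * c) ^ (1 / q) * (a * b) ^ (1 - 1 / q) ≤ C * ‖h‖ := by
    have hexp : 1 - 1 / q = (q - 1) * (1 / q) := by field_simp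
    rw [hexp, Real.rpow_mul (by positivity), ← Real.mul_rpow (by positivity) (by positivity),
      one_div]
    exact (Real.rpow_inv_le_iff_of_pos (by positivity) (by positivity) hq).2 hcoeff
  rw [div_mul_eq_mul_div, div_le_iff₀ (by positivity)]
  calc (c * c) ^ (1 / q) * (a * b) ^ (1 - 1 / q) ≤ C * ‖h‖ := hroot
    _ ≤ C * (2 * (√(a * b) * σ)) := by gcongr
    _ = √(a * b) * σ * (2 * C) := by ring

end LowerBound

section CriticalExponents

theorem critical_rpow_identities {q r t ε : ℝ} (hq : 1 < q)
    (hsum : 1 / r + 1 / t = q / (q - 1) / 2) (hε : 0 < ε) :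
    (ε ^ (2 / t) * ε ^ (2 / r)) ^ (1 - 1 / q) = ε ∧
      √(ε ^ (2 / t) * ε ^ (2 / r)) * ε ^ (1 - 1 / r - 1 / t) = ε := by
  have hq₁ : q - 1 ≠ 0 := by linarith
  have hq₀ : q ≠ 0 := by linarith
  have harea : ε ^ (2 / t) * ε ^ (2 / r) = ε ^ (q / (q - 1)) := by
    rw [← Real.rpow_add hε, show 2 / t + 2 / r = q / (q - 1) by linear_combination 2 * hsum]
  have hexp : q / (q - 1) * (1 - 1 / q) = 1 := by field_simp
  have hexp' : q / (q - 1) * (1 / 2) + (1 - 1 / r - 1 / t) = 1 := by linarith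
  constructor
  · rw [harea, ← Real.rpow_mul hε.le, hexp, Real.rpow_one]
  · rw [harea, Real.sqrt_eq_rpow, ← Real.rpow_mul hε.le, ← Real.rpow_add hε, hexp', Real.rpow_one]

theorem one_lt_mul_one_sub {r t : ℝ} (ht : 0 < t) (h : 1 / r + 1 / t < 1) :
    1 < t * (1 - 1 / r) := by
  have h1 : 1 / t < 1 - 1 / r := by linarith
  rwa [div_lt_iff₀' ht] at h1

theorem exists_isLittleO_norm_zak_near_zero {r t : ℝ} (hr : 1 < r) (ht : 1 < t)
    (hrt : 1 < t * (1 - 1 / r)) (hrt3 : t * (1 - 1 / r) < 3)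
    (htr : 1 < r * (1 - 1 / t)) (htr3 : r * (1 - 1 / t) < 3)
    {g : Lp ℂ 2 (volume : Measure ℝ)} (hgr : momentL2 r g ≠ ⊤) (hgt : momentL2 t (𝓕 g) ≠ ⊤) :
    ∃ G : ℝ → ℂ, g =ᵐ[volume] G ∧ (∀ x, Summable fun n : ℤ => G (x + n)) ∧
      ∃ (x₀ y₀ : ℝ) (σ : ℝ → ℝ), σ =o[𝓝[>] 0] (fun ε : ℝ => ε ^ (1 - 1 / r - 1 / t)) ∧
        ∀ᶠ ε in 𝓝[>] 0, ∀ x y, |x - x₀| ≤ ε ^ (2 / t) → |y - y₀| ≤ ε ^ (2 / r) →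
          ‖zak G x y‖ ≤ σ ε := by
  obtain ⟨G, hgG, hseries⟩ := exists_hasSum_zak hr hrt hgr hgt
  have hG (x : ℝ) : Summable fun n : ℤ => G (x + n) := by
    obtain ⟨_, -, h⟩ := hseries x
    exact (h x 0 (by simp)).1
  have hcont : Continuous (Function.uncurry (zak G)) :=
    continuous_uncurry_of_hasSum_fourierChar (δ := 1 / 8) (by norm_num) fun x₀ => by
      obtain ⟨c, hc, h⟩ := hseries x₀
      exact ⟨c, (summable_norm_of_latticeWeight hr hrt hc).of_norm, fun x y hx => (h x y hx).2⟩
  obtain ⟨x₀, y₀, hzero⟩ :=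
    exists_eq_zero_of_quasiperiodic hcont (zak_add_one_left G) (zak_add_one_right G)
  obtain ⟨d, hd, hd_sum⟩ := hseries x₀
  exact ⟨G, hgG, hG, x₀, y₀, exists_isLittleO_norm_zak_le hr ht hrt hrt3 htr htr3 hd
    (by norm_num : (0 : ℝ) < 1 / 8) (fun x y hx => (hd_sum x y hx).2) hzero⟩

theorem not_isExactCqSystem_of_critical {q r t : ℝ} (hq : 2 < q) (hr : 1 < r) (ht : 1 < t)
    (hsum : 1 / r + 1 / t = q / (q - 1) / 2) (hrt3 : t * (1 - 1 / r) < 3)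
    (htr3 : r * (1 - 1 / t) < 3) {g : Lp ℂ 2 (volume : Measure ℝ)}
    (hgr : momentL2 r g ≠ ⊤) (hgt : momentL2 t (𝓕 g) ≠ ⊤) :
    ¬ IsExactCqSystem q (gaborSystem g) := by
  intro hg
  have hlt : 1 / r + 1 / t < 1 := by
    rw [hsum, div_div, div_lt_one (by linarith)]
    linarith
  have hrt := one_lt_mul_one_sub (zero_lt_one.trans ht) hlt
  have htr := one_lt_mul_one_sub (zero_lt_one.trans hr) (add_comm (1 / r) _ ▸ hlt)
  obtain ⟨G, hgG, hG, x₀, y₀, σ, hσ, hzak⟩ :=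
    exists_isLittleO_norm_zak_near_zero hr ht hrt hrt3 htr htr3 hgr hgt
  obtain ⟨c, hc, hlower⟩ := hg.exists_mul_rpow_le_of_norm_zak_le (by linarith) hgG hG
  have hsmall {s : ℝ} (hs : 0 < s) : ∀ᶠ ε : ℝ in 𝓝[>] 0, ε ^ (2 / s) < 1 / 2 :=
    (tendsto_rpow_nhdsGT_zero (by positivity)).eventually_lt_const (by norm_num)
  have hpos : ∀ᶠ ε : ℝ in 𝓝[>] 0, 0 < ε := self_mem_nhdsWithin
  obtain ⟨ε, hε, hσε, hzakε, ha, hb⟩ := (hpos.and ((hσ.bound (half_pos hc)).and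
    (hzak.and ((hsmall (zero_lt_one.trans ht)).and (hsmall (zero_lt_one.trans hr)))))).exists
  obtain ⟨hpow, hsqrt⟩ := critical_rpow_identities (by linarith) hsum hε
  have hcε : c * ε ≤ c / 2 * ε :=
    calc c * ε ≤ √(ε ^ (2 / t) * ε ^ (2 / r)) * σ ε := by
          simpa only [hpow] using hlower x₀ y₀ _ _ _ (by positivity) ha.le (by positivity) hb.le
            hzakε
      _ ≤ √(ε ^ (2 / t) * ε ^ (2 / r)) * (c / 2 * ε ^ (1 - 1 / r - 1 / t)) := by
          gcongr
          simpa only [Real.norm_of_nonneg (Real.rpow_nonneg hε.le _)] using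
            (le_abs_self _).trans hσε
      _ = c / 2 * ε := by rw [mul_left_comm, hsqrt]
  linarith [mul_pos hc hε]

theorem momentL2_ne_top_of_le {s s' : ℝ} (hs' : 0 ≤ s') (hle : s' ≤ s)
    {f : Lp ℂ 2 (volume : Measure ℝ)} (hf : momentL2 s f ≠ ⊤) : momentL2 s' f ≠ ⊤ := by
  refine ne_top_of_le_ne_top (lintegral_one_add_enorm_rpow_mul_ne_top (hs'.trans hle) hf)
    (lintegral_mono fun x => ?_)
  rw [ENNReal.ofReal_mul (by positivity), ← ENNReal.ofReal_rpow_of_nonneg (abs_nonneg x) hs',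
    ENNReal.ofReal_pow (norm_nonneg _), ofReal_norm, ← Real.norm_eq_abs, ofReal_norm]
  gcongr
  exact (ENNReal.rpow_le_rpow le_add_self hs').trans
    (ENNReal.rpow_le_rpow_of_exponent_le le_self_add hle)

theorem exists_critical_exponents {ρ τ s : ℝ} (hs : 1 / 2 < s) (hρ : ρ < (3 * s - 1) / 2)
    (hτ : τ < (3 * s - 1) / 2) (h : ρ + τ ≤ s) :
    ∃ ρ' τ', ρ ≤ ρ' ∧ τ ≤ τ' ∧ ρ' + τ' = s ∧ (1 - s) / 2 < ρ' ∧ (1 - s) / 2 < τ' := by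
  rcases le_or_gt ρ (s / 2) with hρs | hρs
  · rcases le_or_gt τ (s / 2) with hτs | hτs
    · exact ⟨s / 2, s / 2, hρs, hτs, by ring, by linarith, by linarith⟩
    · exact ⟨s - τ, τ, by linarith, le_rfl, by ring, by linarith, by linarith⟩
  · exact ⟨ρ, s - ρ, le_rfl, by linarith, by ring, by linarith, by linarith⟩

theorem momentL2_eq_top_or {q r t : ℝ} (hq : 2 < q) (hr : 4 * (q - 1) / (q + 2) < r)
    (ht : 4 * (q - 1) / (q + 2) < t) (hsum : 1 / r + 1 / t ≤ (q / (q - 1)) / 2)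
    {g : Lp ℂ 2 (volume : Measure ℝ)} (hg : IsExactCqSystem q (gaborSystem g)) :
    momentL2 r g = ⊤ ∨ momentL2 t (𝓕 g) = ⊤ := by
  by_contra! hfinite
  have hq1 : 0 < q - 1 := by linarith
  set s := (q / (q - 1)) / 2 with hs
  have hs1 : s < 1 := by
    rw [hs, div_div, div_lt_one (by positivity)]
    linarith
  have hs2 : 1 / 2 < s := by
    rw [hs, div_div, div_lt_div_iff₀ (by norm_num) (by positivity)]
    linarith
  have hpos : 0 < 4 * (q - 1) / (q + 2) := by positivity
  have hthreshold : 1 / (4 * (q - 1) / (q + 2)) = (3 * s - 1) / 2 := by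
    rw [hs]
    field_simp
    ring
  obtain ⟨ρ, τ, hρr, hτt, hρτ, hρ, hτ⟩ := exists_critical_exponents hs2
    (hthreshold ▸ one_div_lt_one_div_of_lt hpos hr)
    (hthreshold ▸ one_div_lt_one_div_of_lt hpos ht) hsum
  have hρ0 : 0 < ρ := by linarith
  have hτ0 : 0 < τ := by linarith
  refine not_isExactCqSystem_of_critical (r := 1 / ρ) (t := 1 / τ) hq ?_ ?_ ?_ ?_ ?_
    (momentL2_ne_top_of_le (by positivity) ((one_div_le hρ0 (hpos.trans hr)).2 hρr) hfinite.1)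
    (momentL2_ne_top_of_le (by positivity) ((one_div_le hτ0 (hpos.trans ht)).2 hτt) hfinite.2) hg
  · rw [lt_div_iff₀ hρ0]; linarith
  · rw [lt_div_iff₀ hτ0]; linarith
  · rw [one_div_one_div, one_div_one_div, hρτ]
  · rw [one_div_one_div, one_div_mul_eq_div, div_lt_iff₀ hτ0]; linarith
  · rw [one_div_one_div, one_div_mul_eq_div, div_lt_iff₀ hρ0]; linarith

end CriticalExponents

end

theorem mainTheorem7 (q r t : ℝ) (hq : 2 < q)
    (hr : 4 * (q - 1) / (q + 2) < r) (hrt : r ≤ t)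
    (hsum : 1 / r + 1 / t ≤ (q / (q - 1)) / 2)
    (g : Lp ℂ 2 (volume : Measure ℝ)) (hg : IsExactCqSystem q (gaborSystem g)) :
    (momentL2 r g = ∞ ∨ momentL2 t (𝓕 g) = ∞) ∧
      (momentL2 t g = ∞ ∨ momentL2 r (𝓕 g) = ∞) :=
  ⟨momentL2_eq_top_or hq hr (hr.trans_le hrt) hsum hg,
    momentL2_eq_top_or hq (hr.trans_le hrt) hr (add_comm (1 / r) _ ▸ hsum) hg⟩
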